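/- Fix $n\ge 0$ and work in $\mathbb{Z}[\beta][x_1,\dots,x_n]$. Let $a=(a_1,\dots,a_n)$ denote a weak composition (a sequence of nonnegative integers). Fillings. The skyline diagram of $a$ has $a_i$ left-justified boxes in row $i$, row $1$ being the lowest. A set-valued filling puts a non-empty set of positive integers in each box; the maximum of a box is its anchor, its other entries are free. Three boxes form a triple if $\beta',\alpha$ are adjacent in a row, with $\alpha$ immediately right of $\beta'$, and the third box $\gamma$ lies either (A) above $\alpha$ in the same column, where the lower row is weakly longer, or (B) below $\beta'$ in the same column, where the higher row is strictly longer. It is an inversion triple if its anchors satisfy $\gamma<\alpha\le\beta'$ or $\alpha\le\beta'<\gamma$. Consider the conditions: (S.1) entries do not repeat in a column; (S.2) rows weakly decrease from left to right, where $A\ge B$ means $\min A\ge\max B$; (S.3) every triple of anchors is an inversion triple; (S.4) each free entry is in the box of the least anchor in its column among those boxes where it can stand as a free entry without violating (S.2); (S.5) anchors in the first column equal their row index. For a filling $F$ let $\mathrm{ex}(F)$ be the number of free entries and $\mathbf{x}^{\mathrm{wt}(F)}=\prod_i x_i^{c_i}$, where $c_i$ is the number of $i$'s in $F$. The combinatorial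 Lascoux atom is $\overline{\mathfrak{A}}_a=\sum_F\beta^{\mathrm{ex}(F)}\mathbf{x}^{\mathrm{wt}(F)}$ over all fillings $F$ of shape $a$ that satisfy (S.1)–(S.5). The combinatorial Lascoux polynomial is $\overline{\mathfrak{D}}_a=\sum_F\beta^{\mathrm{ex}(F)}\mathbf{x}^{\mathrm{wt}(F)}$ over all fillings $F$ of the reversed shape $(a_n,\dots,a_1)$ that satisfy (S.1)–(S.4) after a basement column with the single entry $n-i+1$ in row $i$ is added on the left (basement entries count neither for the excess nor for the weight). Orders. Let $\mathtt{sort}(a)$ be the weakly decreasing rearrangement of $a$, let $w(a)\in S_n$ be the permutation of minimal length sending $a$ to $\mathtt{sort}(a)$, and let $\le$ be the strong Bruhat order on $S_n$. A left swap exchanges two entries $a_i\le a_j$ with $i<j$; let $\mathtt{lswap}(a)$ be the set of weak compositions obtained from $a$ by a (possibly empty) sequence of left swaps. Operators. Let $\partial_i f=(f-s_if)/(x_i-x_{i+1})$, where $s_i$ exchanges $x_i$ and $x_{i+1}$, let $\tau_i f=\partial_i\big(x_i(1+\beta x_{i+1})f\big)$ and $\hat\tau_i=\tau_i-1$. The operator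 Lascoux polynomial $\overline{\mathfrak{D}}^{\mathrm{op}}_a$ is $\mathbf{x}^a$ if $a$ is weakly decreasing, and $\tau_i\,\overline{\mathfrak{D}}^{\mathrm{op}}_{s_ia}$ if $a_i<a_{i+1}$ (for definiteness, at the first such $i$), where $s_ia$ is $a$ with $a_i,a_{i+1}$ exchanged. The operator Lascoux atom $\overline{\mathfrak{A}}^{\mathrm{op}}_a$ is defined in the same way with $\hat\tau_i$ in place of $\tau_i$. Theorem. (1) For every weak composition $a$ of length $n$, $$\mathtt{lswap}(a)=\{b:\mathtt{sort}(b)=\mathtt{sort}(a),\ w(b)\le w(a)\}$$ and $$\overline{\mathfrak{D}}_a=\sum_{\substack{\mathtt{sort}(b)=\mathtt{sort}(a)\\ w(b)\le w(a)}}\overline{\mathfrak{A}}_b=\sum_{b\in\mathtt{lswap}(a)}\overline{\mathfrak{A}}_b .$$ In particular $\overline{\mathfrak{D}}_a$ is a linear combination of Lascoux atoms with coefficients in $\mathbb{Z}_{\ge0}[\beta]$. (2) For each $n$, the following two statements are equivalent: $\overline{\mathfrak{A}}^{\mathrm{op}}_a=\overline{\mathfrak{A}}_a$ for all weak compositions $a$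 of length $n$; and $\overline{\mathfrak{D}}^{\mathrm{op}}_a=\overline{\mathfrak{D}}_a$ for all weak compositions $a$ of length $n$. -/

import Mathlib

namespace Lascoux

/-! Conventions. A weak composition of length `n` is a function `a : Fin n → ℕ`; the index
`i : Fin n` stands for position (row, variable) number `i + 1`. Row `0` is the lowest row.
Columns are numbered from `0` on the left. Entries of fillings are positive integers. -/

/-- The ring `ℤ[β][x_1, …, x_n]`. -/
abbrev Poly (n : ℕ) : Type := MvPolynomial (Fin n) (Polynomial ℤ)

/-- The parameter `β` as an element of `ℤ[β][x_1, …, x_n]`. -/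
noncomputable def beta (n : ℕ) : Poly n := MvPolynomial.C Polynomial.X

/-- The monomial `x^c = x_1^{c_1} ⋯ x_n^{c_n}`. -/
noncomputable def monom {n : ℕ} (c : Fin n → ℕ) : Poly n :=
  ∏ i : Fin n, (MvPolynomial.X i : Poly n) ^ c i

/-! ### Set-valued fillings of skyline diagrams -/

/-- An array of finite sets; `F i c` is the content of the box in row `i` and column `c`
(and it is empty if there is no such box). -/
abbrev Filling (n : ℕ) : Type := Fin n → ℕ → Finset ℕ

/-- `F` is a set-valued filling of the left-justified diagram with `d i` boxes in row `i`:
each box holds a non-empty set of positive integers (and nothing is put outside the boxes). -/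
def IsFilling {n : ℕ} (d : Fin n → ℕ) (F : Filling n) : Prop :=
  (∀ i c, (F i c).Nonempty ↔ c < d i) ∧ ∀ i c, ∀ k ∈ F i c, 0 < k

/-- The anchor of a box: its maximum entry. All other entries of the box are free. -/
def anchor {n : ℕ} (F : Filling n) (i : Fin n) (c : ℕ) : ℕ := (F i c).sup id

/-- (S.1): entries do not repeat in a column. -/
def ColumnStrict {n : ℕ} (F : Filling n) : Prop :=
  ∀ c : ℕ, ∀ i j : Fin n, i ≠ j → Disjoint (F i c) (F j c)

/-- (S.2): rows are weakly decreasing, where `A ≥ B` means `min A ≥ max B`. -/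
def RowDecreasing {n : ℕ} (F : Filling n) : Prop :=
  ∀ (i : Fin n) (c : ℕ), ∀ x ∈ F i c, ∀ y ∈ F i (c + 1), y ≤ x

/-- The condition for a triple `α, β, γ` (`α` immediately right of `β`) to be an inversion
triple. -/
def IsInversionTriple (α β γ : ℕ) : Prop := (γ < α ∧ α ≤ β) ∨ (α ≤ β ∧ β < γ)

/-- (S.3): every triple of anchors is an inversion triple. In a triple of type A the lower row
`i` is weakly longer, and the third box lies in a higher row `j`, in the column of the right box
of row `i`. In a triple of type B the higher row `j` is strictly longer, and the third box lies in
the lower row `i`, in the column of the left box of row `j`. -/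
def TriplesInversion {n : ℕ} (d : Fin n → ℕ) (F : Filling n) : Prop :=
  ∀ i j : Fin n, i < j → ∀ c : ℕ,
    (d j ≤ d i → c + 1 < d i → c + 1 < d j →
      IsInversionTriple (anchor F i (c + 1)) (anchor F i c) (anchor F j (c + 1))) ∧
    (d i < d j → c + 1 < d j → c < d i →
      IsInversionTriple (anchor F j (c + 1)) (anchor F j c) (anchor F i c))

/-- The number `k` may stand as a free entry in the box of row `j` and column `c` without violating
(S.2): the box exists, `k` is smaller than its anchor, and the box on the right (if there is one)
has an anchor that is at most `k`. -/
def CanBeFreeIn {n : ℕ} (d : Fin n → ℕ) (F : Filling n) (k : ℕ) (j : Fin n) (c : ℕ) : Prop :=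
  c < d j ∧ k < anchor F j c ∧ (c + 1 < d j → anchor F j (c + 1) ≤ k)

/-- (S.4): each free entry is in the box of the least anchor in its column such that (S.2) is not
violated. -/
def FreeEntriesLow {n : ℕ} (d : Fin n → ℕ) (F : Filling n) : Prop :=
  ∀ (i : Fin n) (c : ℕ), ∀ k ∈ F i c, k ≠ anchor F i c →
    ∀ j : Fin n, CanBeFreeIn d F k j c → anchor F i c ≤ anchor F j c

/-- `F` is a set-valued filling of the diagram `d` that satisfies (S.1), (S.2), (S.3), (S.4). -/
structure IsSemistandard {n : ℕ} (d : Fin n → ℕ) (F : Filling n) : Prop where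
  filling : IsFilling d F
  columns : ColumnStrict F
  rows : RowDecreasing F
  triples : TriplesInversion d F
  free : FreeEntriesLow d F

/-- The number of free entries of a filling of the diagram `d`. -/
def excess {n : ℕ} (d : Fin n → ℕ) (F : Filling n) : ℕ :=
  ∑ i : Fin n, ∑ c ∈ Finset.range (d i), ((F i c).erase (anchor F i c)).card

/-- The weight of a filling of the diagram `d`: for each `v = 1, …, n`, the number of
occurrences of `v`. -/
def weight {n : ℕ} (d : Fin n → ℕ) (F : Filling n) (v : Fin n) : ℕ :=
  ∑ i : Fin n, ((Finset.range (d i)).filter fun c => (v : ℕ) + 1 ∈ F i c).card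

/-! ### Lascoux atoms -/

/-- The semistandard set-valued skyline fillings of shape `a`: conditions (S.1)–(S.4), and
(S.5) anchors in the first column are equal to their row index. -/
def atomFillings {n : ℕ} (a : Fin n → ℕ) : Set (Filling n) :=
  {F | IsSemistandard a F ∧ ∀ i : Fin n, 0 < a i → anchor F i 0 = (i : ℕ) + 1}

/-! ### Lascoux polynomials -/

/-- The array obtained from `F` by adding the basement `b` as a new leftmost column. -/
def withBasement {n : ℕ} (b : Fin n → ℕ) (F : Filling n) : Filling n
  | i, 0 => {b i}
  | i, c + 1 => F i c

/-- The reversal of a weak composition. -/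
def reverse {n : ℕ} (a : Fin n → ℕ) : Fin n → ℕ := fun i => a i.rev

/-- The fillings `F` of shape `reverse a` that are semistandard (conditions (S.1)–(S.4)) when
augmented by the basement with entry `n - i + 1` in row number `i = 1, …, n`, that is, entry
`n - i` in the row with index `i : Fin n`. -/
def lascouxFillings {n : ℕ} (a : Fin n → ℕ) : Set (Filling n) :=
  {F | IsSemistandard (fun i => reverse a i + 1) (withBasement (fun i => n - (i : ℕ)) F)}

/-! ### Finiteness of the sets of fillings -/

theorem finite_of_bounded {n : ℕ} (d : Fin n → ℕ) :
    {F : Filling n | (∀ i c, d i ≤ c → F i c = ∅) ∧ ∀ i c, ∀ k ∈ F i c, k ≤ n}.Finite := by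
  let M := ∑ i, d i
  have hM : ∀ i, d i ≤ M := fun i => Finset.single_le_sum (f := d) (fun _ _ => Nat.zero_le _)
    (Finset.mem_univ i)
  let S : Set (Fin n → Fin M → Finset ℕ) :=
    Set.pi Set.univ fun _ => Set.pi Set.univ fun _ => ↑((Finset.range (n + 1)).powerset)
  have hS : S.Finite := Set.Finite.pi fun _ => Set.Finite.pi fun _ => Finset.finite_toSet _
  refine Set.Finite.of_injOn (f := fun F i (c : Fin M) => F i c) (t := S) ?_ ?_ hS
  · intro F hF i _ c _
    simp only [Finset.coe_powerset, Set.mem_preimage, Set.mem_powerset_iff, Finset.coe_subset]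
    intro k hk
    exact Finset.mem_range.2 (Nat.lt_succ_of_le (hF.2 i c k hk))
  · intro F hF G hG h
    funext i c
    by_cases hc : c < M
    · exact congrFun (congrFun h i) ⟨c, hc⟩
    · have := (hM i).trans (not_lt.1 hc)
      rw [hF.1 i c this, hG.1 i c this]

theorem atomFillings_finite {n : ℕ} (a : Fin n → ℕ) : (atomFillings a).Finite := by
  refine (finite_of_bounded a).subset ?_
  rintro F ⟨hF, h5⟩
  have hne := hF.filling.1
  refine ⟨fun i c hc => ?_, fun i c => ?_⟩
  · by_contra h
    exact absurd ((hne i c).1 (Finset.nonempty_iff_ne_empty.2 h)) (not_lt.2 hc)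
  · induction c with
    | zero =>
      intro k hk
      have h1 := h5 i ((hne i 0).1 ⟨k, hk⟩)
      have h2 : k ≤ anchor F i 0 := Finset.le_sup (f := id) hk
      omega
    | succ c ih =>
      intro k hk
      have h1 := (hne i (c + 1)).1 ⟨k, hk⟩
      obtain ⟨x, hx⟩ := (hne i c).2 (by omega)
      exact (hF.rows i c x hx k hk).trans (ih x hx)

theorem lascouxFillings_finite {n : ℕ} (a : Fin n → ℕ) : (lascouxFillings a).Finite := by
  refine (finite_of_bounded (reverse a)).subset ?_
  intro F hF
  have hne : ∀ i c, (F i c).Nonempty ↔ c < reverse a i := fun i c => by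
    simpa [withBasement] using hF.filling.1 i (c + 1)
  refine ⟨fun i c hc => ?_, fun i c => ?_⟩
  · by_contra h
    exact absurd ((hne i c).1 (Finset.nonempty_iff_ne_empty.2 h)) (not_lt.2 hc)
  · induction c with
    | zero =>
      intro k hk
      have := hF.rows i 0 (n - (i : ℕ)) (by simp [withBasement]) k hk
      omega
    | succ c ih =>
      intro k hk
      have h1 := (hne i (c + 1)).1 ⟨k, hk⟩
      obtain ⟨x, hx⟩ := (hne i c).2 (by omega)
      exact (hF.rows i (c + 1) x hx k hk).trans (ih x hx)

/-- The combinatorial Lascoux atom. -/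
noncomputable def lascouxAtom {n : ℕ} (a : Fin n → ℕ) : Poly n :=
  ∑ F ∈ (atomFillings_finite a).toFinset, beta n ^ excess a F * monom (weight a F)

/-- The combinatorial Lascoux polynomial. The basement contributes neither to the excess nor to
the weight. -/
noncomputable def lascouxPoly {n : ℕ} (a : Fin n → ℕ) : Poly n :=
  ∑ F ∈ (lascouxFillings_finite a).toFinset,
    beta n ^ excess (reverse a) F * monom (weight (reverse a) F)

/-! ### Sorting, Bruhat order, left swaps -/

/-- The rearrangement of the parts of `a` into weakly decreasing order. -/
def sortDesc {n : ℕ} (a : Fin n → ℕ) : Fin n → ℕ := a ∘ Tuple.sort (OrderDual.toDual ∘ a)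

theorem sortDesc_antitone {n : ℕ} (a : Fin n → ℕ) : Antitone (sortDesc a) := fun _ _ h =>
  Tuple.monotone_sort (OrderDual.toDual ∘ a) h

/-- The Coxeter length of a permutation, that is, its number of inversions. -/
def coxeterLength {n : ℕ} (u : Equiv.Perm (Fin n)) : ℕ :=
  (Finset.univ.filter fun p : Fin n × Fin n => p.1 < p.2 ∧ u p.2 < u p.1).card

/-- The permutations `w` that send `a` to its sorted version: the part in position `i` is moved to
position `w i`. -/
def sortingPerms {n : ℕ} (a : Fin n → ℕ) : Finset (Equiv.Perm (Fin n)) :=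
  Finset.univ.filter fun w => ∀ i, sortDesc a (w i) = a i

theorem sortingPerms_nonempty {n : ℕ} (a : Fin n → ℕ) : (sortingPerms a).Nonempty :=
  ⟨(Tuple.sort (OrderDual.toDual ∘ a))⁻¹, 
    Finset.mem_filter.2 ⟨Finset.mem_univ _, fun i => by simp [sortDesc]⟩⟩

/-- The minimal length permutation `w(a)` that sends `a` to `sort(a)`. -/
noncomputable def sortPerm {n : ℕ} (a : Fin n → ℕ) : Equiv.Perm (Fin n) :=
  (Finset.exists_min_image (sortingPerms a) coxeterLength (sortingPerms_nonempty a)).choose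

theorem sortPerm_spec {n : ℕ} (a : Fin n → ℕ) : sortPerm a ∈ sortingPerms a ∧
    ∀ v ∈ sortingPerms a, coxeterLength (sortPerm a) ≤ coxeterLength v :=
  (Finset.exists_min_image (sortingPerms a) coxeterLength (sortingPerms_nonempty a)).choose_spec

/-- The strong Bruhat order on permutations: the reflexive transitive closure of `u < u t` for
transpositions `t` with `u` shorter than `u t`. -/
def BruhatLE {n : ℕ} : Equiv.Perm (Fin n) → Equiv.Perm (Fin n) → Prop :=
  Relation.ReflTransGen fun u v =>
    ∃ i j : Fin n, v = u * Equiv.swap i j ∧ coxeterLength u < coxeterLength v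

/-- The weak compositions `b` with `sort(b) = sort(a)` and `w(b) ≤ w(a)` in Bruhat order. -/
def bruhatBelow {n : ℕ} (a : Fin n → ℕ) : Set (Fin n → ℕ) :=
  {b | sortDesc b = sortDesc a ∧ BruhatLE (sortPerm b) (sortPerm a)}

/-- `b` arises from `a` by a left swap: the exchange of two entries `a_i ≤ a_j` with `i < j`. -/
def LeftSwap {n : ℕ} (a b : Fin n → ℕ) : Prop :=
  ∃ i j : Fin n, i < j ∧ a i ≤ a j ∧ b = a ∘ Equiv.swap i j

/-- The weak compositions obtained from `a` by a (possibly empty) sequence of left swaps. -/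
def lswap {n : ℕ} (a : Fin n → ℕ) : Set (Fin n → ℕ) := {b | Relation.ReflTransGen LeftSwap a b}

theorem rearrangements_finite {n : ℕ} (a : Fin n → ℕ) :
    (Set.range fun s : Equiv.Perm (Fin n) => a ∘ s).Finite := Set.finite_range _

theorem bruhatBelow_finite {n : ℕ} (a : Fin n → ℕ) : (bruhatBelow a).Finite := by
  refine (rearrangements_finite a).subset ?_
  rintro b ⟨hb, -⟩
  refine ⟨(Tuple.sort (OrderDual.toDual ∘ b))⁻¹.trans (Tuple.sort (OrderDual.toDual ∘ a)), ?_⟩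
  funext i
  have := congrFun hb ((Tuple.sort (OrderDual.toDual ∘ b))⁻¹ i)
  simpa [sortDesc] using this.symm

theorem lswap_finite {n : ℕ} (a : Fin n → ℕ) : (lswap a).Finite := by
  refine (rearrangements_finite a).subset ?_
  intro b hb
  induction hb with
  | refl => exact ⟨1, rfl⟩
  | tail _ h ih =>
    obtain ⟨s, rfl⟩ := ih
    obtain ⟨i, j, -, -, rfl⟩ := h
    exact ⟨s * Equiv.swap i j, rfl⟩

/-! ### Operator Lascoux atoms and polynomials -/

/-- The action of the transposition of `x_i` and `x_j` on polynomials. -/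
noncomputable def swapVars {n : ℕ} (i j : Fin n) (f : Poly n) : Poly n :=
  MvPolynomial.rename (Equiv.swap i j) f

theorem sub_dvd_sub_swapVars {n : ℕ} (i j : Fin n) (f : Poly n) :
    (MvPolynomial.X i - MvPolynomial.X j : Poly n) ∣ f - swapVars i j f := by
  unfold swapVars
  induction f using MvPolynomial.induction_on with
  | C c => simp
  | add p q hp hq =>
    rw [map_add, add_sub_add_comm]
    exact dvd_add hp hq
  | mul_X p k hp =>
    rw [map_mul, MvPolynomial.rename_X]
    have key : p * MvPolynomial.X k -
        MvPolynomial.rename (Equiv.swap i j) p * MvPolynomial.X (Equiv.swap i j k) =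
        (p - MvPolynomial.rename (Equiv.swap i j) p) * MvPolynomial.X k +
        MvPolynomial.rename (Equiv.swap i j) p *
          (MvPolynomial.X k - MvPolynomial.X (Equiv.swap i j k)) := by ring
    rw [key]
    refine dvd_add (hp.mul_right _) (Dvd.dvd.mul_left ?_ _)
    rcases eq_or_ne k i with rfl | hi
    · simp
    · rcases eq_or_ne k j with rfl | hj
      · rw [Equiv.swap_apply_right]
        exact ⟨-1, by ring⟩
      · simp [Equiv.swap_apply_of_ne_of_ne hi hj]

/-- The divided difference `(f - s f) / (x_i - x_j)`, where `s` exchanges `x_i` and `x_j`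
(used for `i ≠ j` only). -/
noncomputable def divDiff {n : ℕ} (i j : Fin n) (f : Poly n) : Poly n :=
  (sub_dvd_sub_swapVars i j f).choose

theorem divDiff_spec {n : ℕ} (i j : Fin n) (f : Poly n) :
    f - swapVars i j f = (MvPolynomial.X i - MvPolynomial.X j) * divDiff i j f :=
  (sub_dvd_sub_swapVars i j f).choose_spec

/-- The next index (and the last index itself at the end). -/
def next {n : ℕ} (i : Fin n) : Fin n := if h : (i : ℕ) + 1 < n then ⟨(i : ℕ) + 1, h⟩ else i

/-- The operator `f ↦ ∂_i (x_i (1 + β x_{i+1}) f)`. -/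
noncomputable def tau {n : ℕ} (i : Fin n) (f : Poly n) : Poly n :=
  divDiff i (next i) (MvPolynomial.X i * (1 + beta n * MvPolynomial.X (next i)) * f)

/-- The operator `f ↦ ∂_i (x_i (1 + β x_{i+1}) f) - f`. -/
noncomputable def tauHat {n : ℕ} (i : Fin n) (f : Poly n) : Poly n := tau i f - f

/-- The positions `i` with `a_i < a_{i+1}`. -/
def ascents {n : ℕ} (a : Fin n → ℕ) : Finset (Fin n) :=
  Finset.univ.filter fun i => a i < a (next i)

theorem sum_swap_lt {n : ℕ} (a : Fin n → ℕ) (i : Fin n) (h : a i < a (next i)) :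
    ∑ k : Fin n, (k : ℕ) * (a ∘ Equiv.swap i (next i)) k < ∑ k : Fin n, (k : ℕ) * a k := by
  have hn : ((next i : Fin n) : ℕ) = i + 1 := by
    unfold next at h ⊢
    split_ifs at h ⊢ with h1
    · rfl
    · exact absurd h (lt_irrefl _)
  have hne : i ≠ next i := fun e => by rw [← e] at h; exact lt_irrefl _ h
  have hs : ∀ f : Fin n → ℕ, ∑ k, f k =
      f i + (f (next i) + ∑ k ∈ (Finset.univ.erase i).erase (next i), f k) := fun f => by
    rw [Finset.add_sum_erase _ f (Finset.mem_erase.2 ⟨hne.symm, Finset.mem_univ _⟩),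
      Finset.add_sum_erase _ f (Finset.mem_univ i)]
  rw [hs, hs fun k => (k : ℕ) * a k]
  have hr : ∑ k ∈ (Finset.univ.erase i).erase (next i),
      (k : ℕ) * (a ∘ Equiv.swap i (next i)) k =
      ∑ k ∈ (Finset.univ.erase i).erase (next i), (k : ℕ) * a k := by
    refine Finset.sum_congr rfl fun k hk => ?_
    simp only [Finset.mem_erase, Finset.mem_univ, and_true] at hk
    rw [Function.comp_apply, Equiv.swap_apply_of_ne_of_ne hk.2 hk.1]
  rw [hr]
  simp only [Function.comp_apply, Equiv.swap_apply_left, Equiv.swap_apply_right, hn]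
  nlinarith

/-- The recursion `P_a = x^a` if `a` is weakly decreasing, and `P_a = T_i (P_{s_i a})` if
`a_i < a_{i+1}` (for definiteness, at the first such `i`), for a family of operators `T_i`. -/
noncomputable def operatorPoly {n : ℕ} (T : Fin n → Poly n → Poly n) (a : Fin n → ℕ) : Poly n :=
  if h : (ascents a).Nonempty then
    T ((ascents a).min' h)
      (operatorPoly T (a ∘ Equiv.swap ((ascents a).min' h) (next ((ascents a).min' h))))
  else monom a
termination_by ∑ k : Fin n, (k : ℕ) * a k
decreasing_by
  exact sum_swap_lt a _ (Finset.mem_filter.1 ((ascents a).min'_mem h)).2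

/-- The operator Lascoux polynomial. -/
noncomputable def opLascouxPoly {n : ℕ} (a : Fin n → ℕ) : Poly n := operatorPoly tau a

/-- The operator Lascoux atom. -/
noncomputable def opLascouxAtom {n : ℕ} (a : Fin n → ℕ) : Poly n := operatorPoly tauHat a

end Lascoux

namespace Lascoux

/-! ### Bruhat order on permutations -/

section Bruhat

variable {n : ℕ}

theorem coxeterLength_mul_swap_lt (u : Equiv.Perm (Fin n)) {i j : Fin n} (hij : i < j)
    (hu : u j < u i) : coxeterLength (u * Equiv.swap i j) < coxeterLength u := by
  classical
  unfold coxeterLength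
  set σ := Equiv.swap i j with hσ
  set A := Finset.univ.filter fun p : Fin n × Fin n =>
    p.1 < p.2 ∧ (u * σ) p.2 < (u * σ) p.1 with hA
  set B := Finset.univ.filter fun p : Fin n × Fin n => p.1 < p.2 ∧ u p.2 < u p.1 with hB
  have hAm : ∀ p q, (p, q) ∈ A ↔ p < q ∧ u (σ q) < u (σ p) := fun p q => by
    rw [hA, Finset.mem_filter]
    exact and_iff_right (Finset.mem_univ _)
  have hmem : (i, j) ∈ B := by simp [hB, hij, hu]
  have hσσ : ∀ x, σ (σ x) = x := fun x => Equiv.swap_apply_self i j x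
  -- An inversion of `u * σ` is transported by `σ` when this keeps its two positions in order, and
  -- is left alone otherwise. This injects into the inversions of `u` and misses `(i, j)`.
  let f : Fin n × Fin n → Fin n × Fin n := fun p =>
    if σ p.1 < σ p.2 then (σ p.1, σ p.2) else p
  have hmaps : ∀ p ∈ A, f p ∈ B.erase (i, j) := by
    rintro ⟨p, q⟩ hp
    obtain ⟨hpq, hv⟩ := (hAm p q).1 hp
    simp only [f, Finset.mem_erase, hB, Finset.mem_filter, Finset.mem_univ, true_and]
    split_ifs with h
    · refine ⟨fun he => ?_, h, hv⟩
      rw [Prod.mk.injEq] at he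
      have h1 : p = j := by rw [← hσσ p, he.1, hσ, Equiv.swap_apply_left]
      have h2 : q = i := by rw [← hσσ q, he.2, hσ, Equiv.swap_apply_right]
      rw [h1, h2] at hpq
      exact lt_asymm hij hpq
    · rw [hσ, Equiv.swap_apply_def, Equiv.swap_apply_def] at h hv
      simp only [ne_eq, Prod.mk.injEq]
      split_ifs at h hv <;> subst_vars <;> grind
  have hinj : Set.InjOn f A := by
    rintro ⟨p, q⟩ hp ⟨p', q'⟩ hp' he
    replace hp := (hAm p q).1 (Finset.mem_coe.1 hp)
    replace hp' := (hAm p' q').1 (Finset.mem_coe.1 hp')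
    simp only [f] at he
    split_ifs at he with h1 h2 h2
    · simp only [Prod.mk.injEq, EmbeddingLike.apply_eq_iff_eq] at he
      simp [he]
    · simp only [Prod.mk.injEq] at he
      rw [← he.1, ← he.2, hσσ, hσσ] at h2
      exact absurd hp.1 h2
    · simp only [Prod.mk.injEq] at he
      rw [he.1, he.2, hσσ, hσσ] at h1
      exact absurd hp'.1 h1
    · exact he
  exact (Finset.card_le_card_of_injOn f hmaps hinj).trans_lt (Finset.card_erase_lt_of_mem hmem)

theorem lt_of_coxeterLength_lt {u : Equiv.Perm (Fin n)} {i j : Fin n} (hij : i < j)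
    (h : coxeterLength u < coxeterLength (u * Equiv.swap i j)) : u i < u j := by
  by_contra hu
  have hne : u i ≠ u j := fun he => hij.ne (u.injective he)
  exact lt_asymm h (coxeterLength_mul_swap_lt u hij (lt_of_le_of_ne (not_lt.1 hu) hne.symm))

theorem bruhatLE_mul_swap {u : Equiv.Perm (Fin n)} {i j : Fin n} (hij : i < j)
    (hu : u j < u i) : BruhatLE (u * Equiv.swap i j) u :=
  Relation.ReflTransGen.single ⟨i, j, by rw [mul_assoc, Equiv.swap_mul_self, mul_one],
    coxeterLength_mul_swap_lt u hij hu⟩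

/-- Going down one Bruhat step from `v * swap i j` to `v`, with `i < j`, one has `v i < v j`, so the
parts at `i`, `j` stand in weakly increasing order before the step; the step is a left swap,
possibly of equal parts. -/
theorem lswap_of_bruhatLE {l : Fin n → ℕ} (hl : Antitone l) {u v : Equiv.Perm (Fin n)}
    (h : BruhatLE u v) : l ∘ u ∈ lswap (l ∘ v) := by
  induction h with
  | refl => exact Relation.ReflTransGen.refl
  | @tail v w _ hvw ih =>
    refine Relation.ReflTransGen.trans (Relation.ReflTransGen.single ?_) ih
    obtain ⟨i, j, rfl, hlen⟩ := hvw
    have hs : ∀ x y : Fin n, l ∘ v = (l ∘ (v * Equiv.swap x y)) ∘ Equiv.swap x y := by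
      intro x y
      funext z
      simp
    rcases lt_trichotomy i j with hij | hij | hij
    · refine ⟨i, j, hij, ?_, hs i j⟩
      simpa using hl (lt_of_coxeterLength_lt hij hlen).le
    · subst hij
      rw [Equiv.swap_self] at hlen
      exact absurd hlen (lt_irrefl _)
    · rw [Equiv.swap_comm] at hlen ⊢
      refine ⟨j, i, hij, ?_, hs j i⟩
      simpa using hl (lt_of_coxeterLength_lt hij hlen).le

theorem mem_sortingPerms {a : Fin n → ℕ} {w : Equiv.Perm (Fin n)} :
    w ∈ sortingPerms a ↔ ∀ i, sortDesc a (w i) = a i := by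
  simp [sortingPerms]

theorem sortDesc_comp_perm (a : Fin n → ℕ) (s : Equiv.Perm (Fin n)) :
    sortDesc (a ∘ s) = sortDesc a := by
  have := Tuple.comp_perm_comp_sort_eq_comp_sort (f := OrderDual.toDual ∘ a) (σ := s)
  exact this

/-- A sorting permutation that preserves the order of equal parts orders positions by decreasing
part and then by index. This total order determines it. -/
theorem eq_of_stable {a : Fin n → ℕ} {u v : Equiv.Perm (Fin n)} (hu : u ∈ sortingPerms a)
    (hv : v ∈ sortingPerms a) (hu' : ∀ i j, i < j → a i = a j → u i < u j)
    (hv' : ∀ i j, i < j → a i = a j → v i < v j) : u = v := by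
  have key : ∀ w : Equiv.Perm (Fin n), w ∈ sortingPerms a →
      (∀ i j, i < j → a i = a j → w i < w j) →
      ∀ i j, w i < w j ↔ a j < a i ∨ (a i = a j ∧ i < j) := by
    intro w hw hw' i j
    have h0 : ∀ i j, a j < a i → w i < w j := by
      intro i j h
      by_contra hcon
      have := sortDesc_antitone a (not_lt.1 hcon)
      rw [mem_sortingPerms.1 hw, mem_sortingPerms.1 hw] at this
      omega
    have h1 := h0 i j
    have h2 := h0 j i
    have h3 := hw' i j
    have h4 := hw' j i
    rcases lt_trichotomy i j with h | h | h
    · grind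
    · grind
    · grind
  have hlt : ∀ i j, u i < u j ↔ v i < v j := fun i j => by rw [key u hu hu', key v hv hv']
  let e : Fin n ≃o Fin n := StrictMono.orderIsoOfSurjective (fun x => v (u.symm x))
    (fun x y hxy => (hlt _ _).1 (by simpa using hxy)) (v.surjective.comp u.symm.surjective)
  have he : e = OrderIso.refl _ := Subsingleton.elim _ _
  ext i
  have := congrArg (fun f : Fin n ≃o Fin n => f (u i)) he
  have h2 : v (u.symm (u i)) = u i := this
  rw [Equiv.symm_apply_apply] at h2
  rw [h2]

theorem swap_mem_sortingPerms {a : Fin n → ℕ} {v : Equiv.Perm (Fin n)} (hv : v ∈ sortingPerms a)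
    {i j : Fin n} (hij : a i = a j) : v * Equiv.swap i j ∈ sortingPerms a := by
  rw [mem_sortingPerms] at hv ⊢
  intro x
  rw [Equiv.Perm.mul_apply, hv, Equiv.swap_apply_def]
  split_ifs <;> subst_vars <;> simp [hij]

/-- An inversion between equal parts can be undone by a transposition that still sorts and is
shorter. The process ends at the stable sorting permutation, and one of minimal length is stable for
the same reason. -/
theorem sortPerm_bruhatLE {a : Fin n → ℕ} (v : Equiv.Perm (Fin n)) (hv : v ∈ sortingPerms a) :
    BruhatLE (sortPerm a) v := by
  induction hlen : coxeterLength v using Nat.strong_induction_on generalizing v with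
  | _ l ih =>
  by_cases h : ∃ i j, i < j ∧ a i = a j ∧ v j < v i
  · obtain ⟨i, j, hij, ha, hvij⟩ := h
    exact (ih _ (hlen ▸ coxeterLength_mul_swap_lt v hij hvij) _
      (swap_mem_sortingPerms hv ha) rfl).trans (bruhatLE_mul_swap hij hvij)
  · push Not at h
    have hst := sortPerm_spec a
    rw [eq_of_stable hst.1 hv (fun i j hij ha => ?_)
      fun i j hij ha => lt_of_le_of_ne (h i j hij ha) fun he => hij.ne (v.injective he)]
    · exact Relation.ReflTransGen.refl
    · by_contra hcon
      have hlt := lt_of_le_of_ne (not_lt.1 hcon) fun he => hij.ne' ((sortPerm a).injective he)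
      exact absurd (hst.2 _ (swap_mem_sortingPerms hst.1 ha))
        (not_le.2 (coxeterLength_mul_swap_lt _ hij hlt))

theorem sortDesc_comp_sortPerm (a : Fin n → ℕ) : sortDesc a ∘ sortPerm a = a :=
  funext (mem_sortingPerms.1 (sortPerm_spec a).1)

theorem lswap_eq_bruhatBelow (a : Fin n → ℕ) : lswap a = bruhatBelow a := by
  ext b
  constructor
  · intro h
    induction h with
    | refl => exact ⟨rfl, Relation.ReflTransGen.refl⟩
    | @tail c b _ hcb ih =>
      obtain ⟨i, j, hij, hle, rfl⟩ := hcb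
      refine ⟨(sortDesc_comp_perm _ _).trans ih.1, Relation.ReflTransGen.trans ?_ ih.2⟩
      have hw := mem_sortingPerms.1 (sortPerm_spec c).1
      rcases hle.eq_or_lt with he | hlt
      · have : c ∘ Equiv.swap i j = c := by
          funext x
          rw [Function.comp_apply, Equiv.swap_apply_def]
          split_ifs <;> subst_vars <;> simp [he]
        rw [this]
      · have hwij : sortPerm c j < sortPerm c i := by
          by_contra hcon
          have := sortDesc_antitone c (not_lt.1 hcon)
          rw [hw, hw] at this
          omega
        refine Relation.ReflTransGen.trans (sortPerm_bruhatLE (sortPerm c * Equiv.swap i j) ?_)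
          (bruhatLE_mul_swap hij hwij)
        rw [mem_sortingPerms]
        intro x
        rw [sortDesc_comp_perm, Equiv.Perm.mul_apply, hw, Function.comp_apply]
  · rintro ⟨hs, hb⟩
    have := lswap_of_bruhatLE (sortDesc_antitone a) hb
    rwa [sortDesc_comp_sortPerm, ← hs, sortDesc_comp_sortPerm] at this

end Bruhat

/-! ### Anchor fillings -/

section AnchorFillings

/-- An array of anchors for the diagram with `d i` boxes in row `i`, augmented by a basement
column `0` with entry `i + 1` in row `i`. The relation `r i j` says that row `i` is drawn below
row `j`. -/
structure AnchorFilling {n : ℕ} (r : Fin n → Fin n → Prop) (d : Fin n → ℕ)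
    (G : Fin n → ℕ → ℕ) : Prop where
  basement : ∀ i, G i 0 = i + 1
  pos : ∀ i c, c ≤ d i → 0 < G i c
  zero : ∀ i c, d i < c → G i c = 0
  row : ∀ i c, G i (c + 1) ≤ G i c
  column : ∀ i j c, i ≠ j → c ≤ d i → c ≤ d j → G i c ≠ G j c
  long : ∀ i j, r i j → d j ≤ d i → ∀ c < d j, G j (c + 1) < G i (c + 1) ∨ G i c < G j (c + 1)
  short : ∀ i j, r i j → d i < d j → ∀ c ≤ d i, G i c < G j (c + 1) ∨ G j c < G i c

/-- The array `G` with the entry in row `p` and column `s` replaced by `k`. -/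
def setEntry {n : ℕ} (G : Fin n → ℕ → ℕ) (p : Fin n) (s k : ℕ) : Fin n → ℕ → ℕ :=
  fun i c => if i = p ∧ c = s then k else G i c

/-- The entry `k` is minimal outside the basement, and column `s` is the last one where it
occurs. -/
structure IsLastMin {n : ℕ} (G : Fin n → ℕ → ℕ) (k s : ℕ) : Prop where
  pos : 0 < k
  column_pos : 0 < s
  le : ∀ i c, 0 < c → G i c ≠ 0 → k ≤ G i c
  lt : ∀ i c, s < c → G i c ≠ 0 → k < G i c

variable {n : ℕ} {d : Fin n → ℕ} {G : Fin n → ℕ → ℕ} {r : Fin n → Fin n → Prop}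
  {p : Fin n} {k s : ℕ}

/-! ### Row comparisons in anchor fillings; deleting and inserting a minimal entry. -/

namespace AnchorFilling

theorem le_basement (h : AnchorFilling r d G) (i : Fin n) (c : ℕ) : G i c ≤ i + 1 := by
  induction c with
  | zero => rw [h.basement]
  | succ c ih => exact (h.row i c).trans ih

theorem ne_zero_iff (h : AnchorFilling r d G) (i : Fin n) (c : ℕ) : G i c ≠ 0 ↔ c ≤ d i := by
  constructor
  · intro h1
    by_contra h2
    exact h1 (h.zero i c (by omega))
  · intro h1
    exact (h.pos i c h1).ne'

/-- A further box in the row would hold an entry at most `k` in a column beyond `s`, where all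
entries exceed `k`. -/
theorem length_eq (h : AnchorFilling r d G) {k s : ℕ} (hm : IsLastMin G k s) {p : Fin n}
    (hp : G p s = k) : d p = s := by
  have h1 : s ≤ d p := (h.ne_zero_iff p s).1 (by have := hm.pos; omega)
  by_contra h2
  have h3 := (h.ne_zero_iff p (s + 1)).2 (by omega)
  have := hm.lt p (s + 1) (by omega) h3
  have := h.row p s
  omega

/-- The basement starts with `G i 0 < G j 0`. From then on the alternative `G j c < G i c` of the
triple condition is excluded, and the other one carries the inequality to the next column. -/
theorem lt_of_short (h : AnchorFilling (· < ·) d G) {i j : Fin n} (hij : i < j) (hd : d i < d j)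
    (c : ℕ) (hc : c ≤ d i) : G i c < G j (c + 1) := by
  have key : ∀ c ≤ d i, G i c < G j c := by
    intro c
    induction c with
    | zero => intro _; rw [h.basement, h.basement]; simpa using hij
    | succ c ih =>
      intro hc
      have h1 := ih (by omega)
      have h2 := h.short i j hij hd c (by omega)
      have h3 := h.row i c
      omega
  have h1 := key c hc
  have h2 := h.short i j hij hd c hc
  omega

theorem lt_of_long (h : AnchorFilling (· > ·) d G) {i j : Fin n} (hij : j < i) (hd : d j ≤ d i)
    (c : ℕ) (hc : c ≤ d j) : G j c < G i c := by
  induction c with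
  | zero => rw [h.basement, h.basement]; simpa using hij
  | succ c ih =>
    have h1 := ih (by omega)
    have h2 := h.long i j hij hd c (by omega)
    have h3 := h.row j c
    omega

/-- The triple conditions with the basement imply (S.5): a smaller entry in the first box of row `j`
would equal the basement entry of a lower row `i`, and the triple on that basement box (or on its
right neighbour) forbids this. -/
theorem eq_of_column_one (h : AnchorFilling (· < ·) d G) (j : Fin n) (hj : 0 < d j) :
    G j 1 = j + 1 := by
  by_contra hne
  have h0 := h.row j 0
  rw [zero_add, h.basement] at h0
  have hp := h.pos j 1 hj
  have hi : G j 1 - 1 < n := by omega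
  let i : Fin n := ⟨G j 1 - 1, hi⟩
  have hij : i < j := by
    rw [Fin.lt_def]
    show G j 1 - 1 < j
    omega
  have hb : G i 0 = G j 1 := by
    rw [h.basement]
    show G j 1 - 1 + 1 = _
    omega
  by_cases hd : d i < d j
  · have := h.lt_of_short hij hd 0 (Nat.zero_le _)
    rw [zero_add] at this
    omega
  · have h1 := h.long i j hij (not_lt.1 hd) 0 hj
    have h2 := h.row i 0
    simp only [zero_add] at h1 h2
    omega

/-- Once the second alternative of the triple condition holds at the last column, it spreads to the
left: the first alternative at `c` would make row `j` increase. -/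
theorem lt_next_of_last (h : AnchorFilling r d G) {i j : Fin n} (hij : r i j) (hd : d j ≤ d i)
    (hlast : G i (d j - 1) < G j (d j)) (c : ℕ) (hc : c < d j) :
    G i c < G j (c + 1) := by
  obtain ⟨t, ht⟩ : ∃ t, d j = c + 1 + t := ⟨d j - (c + 1), by omega⟩
  induction t generalizing c with
  | zero =>
    rw [add_zero] at ht
    rwa [ht, Nat.add_sub_cancel] at hlast
  | succ t ih =>
    have h1 := ih (c + 1) (by omega) (by omega)
    have h2 := h.long i j hij hd c hc
    have h3 := h.row j (c + 1)
    omega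

theorem lt_of_last (h : AnchorFilling r d G) {i j : Fin n} (hij : r i j) (hd : d i < d j)
    (hlast : G j (d i) < G i (d i)) (c : ℕ) (hc : c ≤ d i) : G j c < G i c := by
  obtain ⟨t, ht⟩ : ∃ t, d i = c + t := ⟨d i - c, by omega⟩
  induction t generalizing c with
  | zero => rwa [ht] at hlast
  | succ t ih =>
    have h1 := ih (c + 1) (by omega) (by omega)
    have h2 := h.short i j hij hd c hc
    have h3 := h.row i c
    omega

/-- This identifies `p` from the shape after deletion. A lower row of length `s - 1` would end in an
entry smaller than `k`; that is possible only in the basement, where `k ≤ i + 1` rules it out. -/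
theorem atom_remove_length_ne (h : AnchorFilling (· < ·) d G) {k s : ℕ} (hm : IsLastMin G k s)
    {p : Fin n} (hp : G p s = k) (i : Fin n) (hi : i < p) (hk : k ≤ i + 1) : d i ≠ s - 1 := by
  intro hs
  have hd := h.length_eq hm hp
  have := hm.column_pos
  have h1 := h.lt_of_short hi (by omega) (s - 1) (by omega)
  rw [Nat.sub_add_cancel this, hp] at h1
  rcases Nat.eq_zero_or_pos (s - 1) with h2 | h2
  · rw [h2, h.basement] at h1
    omega
  · have := hm.le i (s - 1) h2 (h.pos i _ (by omega)).ne'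
    omega

/-- By `lt_of_long`, an earlier row of length `s` would have an entry below the minimum `k` in
column `s`. -/
theorem key_remove_length_ne (h : AnchorFilling (· > ·) d G) {k s : ℕ} (hm : IsLastMin G k s)
    {p : Fin n} (hp : G p s = k) (i : Fin n) (hi : i < p) : d i ≠ s := by
  intro hs
  have hd := h.length_eq hm hp
  have h1 := h.lt_of_long hi (by omega) s (by omega)
  have := hm.le i s hm.column_pos (h.pos i _ (by omega)).ne'
  omega

/-- Only pairs whose length comparison is reversed by the deletion need an argument: a lower row of
length `s - 1`, which must then be empty, and a higher row of length `s`. -/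
theorem atom_remove (h : AnchorFilling (· < ·) d G) {k s : ℕ} (hm : IsLastMin G k s)
    {p : Fin n} (hp : G p s = k) :
    AnchorFilling (· < ·) (Function.update d p (s - 1)) (setEntry G p s 0) := by
  have hd := h.length_eq hm hp
  have hs := hm.column_pos
  constructor
  · intro i
    simp only [setEntry]
    rw [if_neg (by omega), h.basement]
  · intro i c hc
    simp only [setEntry, Function.update_apply] at hc ⊢
    have := h.pos i c
    grind
  · intro i c hc
    simp only [setEntry, Function.update_apply] at hc ⊢
    have := h.zero i c
    grind
  · intro i c
    simp only [setEntry]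
    have := h.row i c
    have := h.zero i (c + 1)
    grind
  · intro i j c hij hi hj
    simp only [setEntry, Function.update_apply] at hi hj ⊢
    have := h.column i j c hij
    grind
  · intro i j hij hd' c hc
    simp only [setEntry, Function.update_apply] at hd' hc ⊢
    have hl := h.long i j hij
    have hne := h.atom_remove_length_ne hm hp
    have h3 := h.lt_of_short hij
    have h4 := hm.le
    have h5 := h.pos
    grind
  · intro i j hij hd' c hc
    simp only [setEntry, Function.update_apply] at hd' hc ⊢
    have hl := h.short i j hij
    have hne := h.atom_remove_length_ne hm hp i
    have h4 := hm.le
    have h5 := h.pos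
    -- A pair that was long becomes short. In column `s` row `j` cannot be below the minimum `k`, so
    -- the second alternative holds there and hence in all columns.
    have h6 : i = p → d j = s → ∀ c < s, G i c < G j (c + 1) := by
      intro hi hj
      have := h.lt_next_of_last hij (by rw [hi, hd, hj]) (by
        have h7 := h.long i j hij (by rw [hi, hd, hj]) (s - 1) (by omega)
        rw [Nat.sub_add_cancel hs, hi, hp] at h7
        have := hm.le j s hs (h.pos j s hj.ge).ne'
        rw [hi, hj]
        omega)
      rwa [hj] at this
    grind

theorem key_remove (h : AnchorFilling (· > ·) d G) {k s : ℕ} (hm : IsLastMin G k s)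
    {p : Fin n} (hp : G p s = k) :
    AnchorFilling (· > ·) (Function.update d p (s - 1)) (setEntry G p s 0) := by
  have hd := h.length_eq hm hp
  have hs := hm.column_pos
  constructor
  · intro i
    simp only [setEntry]
    rw [if_neg (by omega), h.basement]
  · intro i c hc
    simp only [setEntry, Function.update_apply] at hc ⊢
    have := h.pos i c
    grind
  · intro i c hc
    simp only [setEntry, Function.update_apply] at hc ⊢
    have := h.zero i c
    grind
  · intro i c
    simp only [setEntry]
    have := h.row i c
    have := h.zero i (c + 1)
    grind
  · intro i j c hij hi hj
    simp only [setEntry, Function.update_apply] at hi hj ⊢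
    have := h.column i j c hij
    grind
  · intro i j hij hd' c hc
    simp only [setEntry, Function.update_apply] at hd' hc ⊢
    have hl := h.long i j hij
    have hne := h.key_remove_length_ne hm hp
    -- A pair that was short becomes long. The last entry of row `i` is not below `k`, by minimality
    -- or, if the row is empty, by its basement entry; so `lt_of_last` applies.
    have h6 : j = p → d i + 1 = s → ∀ c < s, G j c < G i c := by
      intro hj hi c hc
      refine h.lt_of_last hij (by rw [hj, hd]; omega) ?_ c (by omega)
      have h7 := h.short i j hij (by rw [hj, hd]; omega) (d i) le_rfl
      rw [hi, hj, hp] at h7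
      rw [hj]
      by_cases h8 : d i = 0
      · rw [h8, h.basement, h.basement]
        subst hj
        simpa using hij
      · have := hm.le i (d i) (by omega) (h.pos i _ le_rfl).ne'
        omega
    have h4 := h.row
    grind
  · intro i j hij hd' c hc
    simp only [setEntry, Function.update_apply] at hd' hc ⊢
    have hl := h.short i j hij
    have hne := h.key_remove_length_ne hm hp j
    grind

/-- The converse of `atom_remove`; `hmin` is the condition that `atom_remove_length_ne` shows to be
necessary. Again only pairs with reversed length comparison matter. -/
theorem atom_insert (h : AnchorFilling (· < ·) (Function.update d p (s - 1)) G) (hd : d p = s)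
    (hs : 0 < s) (hk : 0 < k) (hkp : k ≤ p + 1)
    (hmin : ∀ i < p, k ≤ i + 1 → d i ≠ s - 1)
    (hle : ∀ i c, 0 < c → G i c ≠ 0 → k ≤ G i c) (hlt : ∀ i c, s ≤ c → G i c ≠ 0 → k < G i c) :
    AnchorFilling (· < ·) d (setEntry G p s k) := by
  have hbase := h.basement
  have hpos := h.pos
  have hzero := h.zero
  have hrow := h.row
  have hcol := h.column
  have hlong := h.long
  have hshort := h.short
  have hbd := h.le_basement
  simp only [Function.update_apply] at hpos hzero hcol hlong hshort
  have hpp := hle p (s - 1)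
  constructor
  · intro i
    simp only [setEntry]
    rw [if_neg (by omega), hbase]
  · intro i c hc
    have := hpos i c
    simp only [setEntry]
    grind
  · intro i c hc
    have := hzero i c
    simp only [setEntry]
    grind
  · intro i c
    have := hrow i c
    have := hzero i c
    have := hlt i c
    have := hpos p (s - 1)
    simp only [setEntry]
    clear hpos hzero hrow hcol hlong hshort hle hlt hmin hbd h
    grind
  · intro i j c hij hi hj
    have := hcol i j c hij
    have := hlt i c
    have := hlt j c
    have := hpos i c
    have := hpos j c
    simp only [setEntry]
    clear hpos hzero hrow hcol hlong hshort hle hlt hmin hbd hbase hpp h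
    split_ifs with h1 h2 h2
    · exact absurd (h1.1.trans h2.1.symm) hij
    all_goals grind
  · intro i j hij hd' c hc
    have hl := hlong i j hij
    simp only [setEntry]
    have h6 : i = p → d j = s → ∀ c < s, G i c < G j (c + 1) := by
      intro hi hj c hc
      exact h.lt_of_short hij (by subst hi; simp [hij.ne', hj]; omega) c (by subst hi; simp; omega)
    have := hlt i (c + 1)
    have := hpos i (c + 1)
    clear hpos hzero hrow hcol hlong hshort hle hlt hmin hbd hbase hpp h
    grind
  · intro i j hij hd' c hc
    have hl := hshort i j hij
    simp only [setEntry]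
    by_cases hi : i = p
    · subst hi
      rw [if_pos rfl, if_neg hij.ne'] at hl
      have := hlt j (c + 1)
      have := hpos j (c + 1)
      clear hpos hzero hrow hcol hlong hshort hle hlt hmin hbd hbase hpp h
      grind
    · by_cases hj : j = p
      · subst hj
        -- By `hmin` such a row has `i + 1 < k`. Its entries are at most `i + 1`, hence too small to
        -- lie outside the basement, so the row is empty.
        have h6 : d i = s - 1 → s = 1 ∧ G i 0 < k := by
          intro hd1
          have h7 := hmin i hij
          have h8 : i + 1 < k := by
            by_contra hcon
            exact h7 (by omega) hd1
          have h9 := hpos i (d i) (by rw [if_neg hi])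
          have h10 := hbd i (d i)
          have h11 : d i = 0 := by
            by_contra hcon
            have := hle i (d i) (by omega) (by omega)
            omega
          exact ⟨by omega, by rw [hbase]; exact h8⟩
        rw [if_pos rfl, if_neg hi] at hl
        clear hpos hzero hrow hcol hlong hshort hle hlt hmin hbd hbase hpp h
        grind
      · clear hpos hzero hrow hcol hlong hshort hle hlt hmin hbd hbase hpp h
        grind

/-- The converse of `key_remove`. An earlier row of length `s` is excluded by `hmin`; a later row of
length `s - 1` is handled by `lt_of_long`. -/
theorem key_insert (h : AnchorFilling (· > ·) (Function.update d p (s - 1)) G) (hd : d p = s)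
    (hs : 0 < s) (hk : 0 < k) (hkp : k ≤ p + 1)
    (hmin : ∀ i < p, d i ≠ s)
    (hle : ∀ i c, 0 < c → G i c ≠ 0 → k ≤ G i c) (hlt : ∀ i c, s ≤ c → G i c ≠ 0 → k < G i c) :
    AnchorFilling (· > ·) d (setEntry G p s k) := by
  have hbase := h.basement
  have hpos := h.pos
  have hzero := h.zero
  have hrow := h.row
  have hcol := h.column
  have hlong := h.long
  have hshort := h.short
  have hbd := h.le_basement
  simp only [Function.update_apply] at hpos hzero hcol hlong hshort
  have hpp := hle p (s - 1)
  constructor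
  · intro i
    simp only [setEntry]
    rw [if_neg (by omega), hbase]
  · intro i c hc
    have := hpos i c
    simp only [setEntry]
    grind
  · intro i c hc
    have := hzero i c
    simp only [setEntry]
    grind
  · intro i c
    have := hrow i c
    have := hzero i c
    have := hlt i c
    have := hpos p (s - 1)
    simp only [setEntry]
    clear hpos hzero hrow hcol hlong hshort hle hlt hmin hbd h
    grind
  · intro i j c hij hi hj
    have := hcol i j c hij
    have := hlt i c
    have := hlt j c
    have := hpos i c
    have := hpos j c
    simp only [setEntry]
    clear hpos hzero hrow hcol hlong hshort hle hlt hmin hbd hbase hpp h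
    split_ifs with h1 h2 h2
    · exact absurd (h1.1.trans h2.1.symm) hij
    all_goals grind
  · intro i j hij hd' c hc
    have hl := hlong i j hij
    have := hmin j
    simp only [setEntry]
    have := hlt i (c + 1)
    have := hpos i (c + 1)
    clear hpos hzero hrow hcol hlong hshort hle hlt hmin hbd hbase hpp h
    grind
  · intro i j hij hd' c hc
    have hl := hshort i j hij
    simp only [setEntry]
    by_cases hi : i = p
    · subst hi
      rw [if_pos rfl, if_neg hij.ne] at hl
      have := hlt j (c + 1)
      have := hpos j (c + 1)
      clear hpos hzero hrow hcol hlong hshort hle hlt hmin hbd hbase hpp h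
      grind
    · by_cases hj : j = p
      · subst hj
        have h6 : d i = s - 1 → ∀ c ≤ d i, G j c < G i c := by
          intro hd1 c hc
          exact h.lt_of_long hij (by simp [hi, hd1]) c (by simp; omega)
        rw [if_pos rfl, if_neg hi] at hl
        clear hpos hzero hrow hcol hlong hshort hle hlt hmin hbd hbase hpp h
        grind
      · clear hpos hzero hrow hcol hlong hshort hle hlt hmin hbd hbase hpp h
        grind

end AnchorFilling

end AnchorFillings

/-! ### Left swaps and dominance -/

section Dominance

variable {n : ℕ}

/-- The number of parts of size at least `m` among the first `k` parts of `a`. -/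
def countGE (a : Fin n → ℕ) (k m : ℕ) : ℕ :=
  (Finset.univ.filter fun i : Fin n => (i : ℕ) < k ∧ m ≤ a i).card

/-- The number of parts of size in `[m, M)` among the first `k` parts of `a`. -/
def countIco (a : Fin n → ℕ) (k m M : ℕ) : ℕ :=
  (Finset.univ.filter fun i : Fin n => (i : ℕ) < k ∧ m ≤ a i ∧ a i < M).card

/-- Every initial segment of `b` contains at least as many large parts as the one of `a`, and `b` has
the same parts as `a`. -/
structure Dominates (b a : Fin n → ℕ) : Prop where
  le : ∀ k m, countGE a k m ≤ countGE b k m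
  eq : ∀ m, countGE a n m = countGE b n m

theorem Dominates.trans {a b c : Fin n → ℕ} (h : Dominates c b) (h' : Dominates b a) :
    Dominates c a :=
  ⟨fun k m => (h'.le k m).trans (h.le k m), fun m => (h'.eq m).trans (h.eq m)⟩

theorem Dominates.refl (a : Fin n → ℕ) : Dominates a a := ⟨fun _ _ => le_rfl, fun _ => rfl⟩

theorem countGE_eq_add (a : Fin n → ℕ) (k : ℕ) {m M : ℕ} (h : m ≤ M) :
    countGE a k m = countGE a k M + countIco a k m M := by
  unfold countGE countIco
  rw [← Finset.card_union_of_disjoint]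
  · congr 1
    ext i
    simp only [Finset.mem_filter, Finset.mem_univ, true_and, Finset.mem_union]
    omega
  · rw [Finset.disjoint_left]
    intro i
    simp only [Finset.mem_filter, Finset.mem_univ, true_and]
    omega

theorem countGE_succ (a : Fin n → ℕ) (k : Fin n) (m : ℕ) :
    countGE a (k + 1) m = countGE a k m + if m ≤ a k then 1 else 0 := by
  unfold countGE
  split_ifs with h
  · rw [← Finset.card_insert_of_notMem (a := k) (by simp)]
    congr 1
    ext i
    simp only [Finset.mem_filter, Finset.mem_univ, true_and, Finset.mem_insert, Fin.ext_iff]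
    constructor
    · omega
    · rintro (h1 | h1)
      · rw [← Fin.ext_iff] at h1
        subst h1
        omega
      · omega
  · rw [add_zero]
    congr 1
    ext i
    simp only [Finset.mem_filter, Finset.mem_univ, true_and]
    constructor
    · rintro ⟨h1, h2⟩
      refine ⟨?_, h2⟩
      rcases Nat.lt_succ_iff_lt_or_eq.1 h1 with h3 | h3
      · exact h3
      · rw [← Fin.ext_iff] at h3
        subst h3
        exact absurd h2 h
    · omega

theorem countGE_congr {a b : Fin n → ℕ} {k : ℕ} (h : ∀ i : Fin n, (i : ℕ) < k → a i = b i) (m : ℕ) :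
    countGE a k m = countGE b k m := by
  unfold countGE
  congr 1
  ext i
  simp only [Finset.mem_filter, Finset.mem_univ, true_and]
  constructor <;> rintro ⟨h1, h2⟩ <;> have := h i h1 <;> omega

theorem countIco_congr {a b : Fin n → ℕ} {k : ℕ} (h : ∀ i : Fin n, (i : ℕ) < k → a i = b i)
    (m M : ℕ) : countIco a k m M = countIco b k m M := by
  unfold countIco
  congr 1
  ext i
  simp only [Finset.mem_filter, Finset.mem_univ, true_and]
  constructor <;> rintro ⟨h1, h2⟩ <;> have := h i h1 <;> omega

theorem countGE_comp_swap (a : Fin n → ℕ) {i j : Fin n} {k : ℕ} (h : (i : ℕ) < k ↔ (j : ℕ) < k)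
    (m : ℕ) : countGE (a ∘ Equiv.swap i j) k m = countGE a k m := by
  unfold countGE
  refine Finset.card_bijective (Equiv.swap i j) (Equiv.swap i j).bijective fun x => ?_
  simp only [Finset.mem_filter, Finset.mem_univ, true_and, Function.comp_apply]
  refine and_congr_left fun _ => ?_
  rw [Equiv.swap_apply_def]
  split_ifs <;> subst_vars <;> simp [h]

theorem dominates_comp_swap (a : Fin n → ℕ) {i j : Fin n} (hij : i < j) (h : a i ≤ a j) :
    Dominates (a ∘ Equiv.swap i j) a := by
  have hij' : (i : ℕ) < j := hij
  refine ⟨fun k m => ?_, fun m => (countGE_comp_swap a (by simp) m).symm⟩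
  by_cases hk : (i : ℕ) < k ↔ (j : ℕ) < k
  · exact (countGE_comp_swap a hk m).ge
  · refine Finset.card_le_card fun x => ?_
    simp only [Finset.mem_filter, Finset.mem_univ, true_and, Function.comp_apply]
    rw [Equiv.swap_apply_def]
    rintro ⟨h1, h2⟩
    split_ifs <;> subst_vars <;> omega

theorem dominates_of_mem_lswap {a b : Fin n → ℕ} (h : b ∈ lswap a) : Dominates b a := by
  induction h with
  | refl => exact Dominates.refl a
  | tail _ h ih =>
    obtain ⟨i, j, hij, hle, rfl⟩ := h
    exact (dominates_comp_swap _ hij hle).trans ih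

/-- The sum of the products of the parts with their positions. -/
def moment (a : Fin n → ℕ) : ℕ := ∑ k : Fin n, (k : ℕ) * a k

theorem moment_comp_swap_lt (a : Fin n → ℕ) {i j : Fin n} (hij : i < j) (h : a i < a j) :
    moment (a ∘ Equiv.swap i j) < moment a := by
  have hne : i ≠ j := hij.ne
  have hs : ∀ f : Fin n → ℕ, ∑ k, f k =
      f i + (f j + ∑ k ∈ (Finset.univ.erase i).erase j, f k) := fun f => by
    rw [Finset.add_sum_erase _ f (Finset.mem_erase.2 ⟨hne.symm, Finset.mem_univ _⟩),
      Finset.add_sum_erase _ f (Finset.mem_univ i)]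
  unfold moment
  rw [hs, hs fun k => (k : ℕ) * a k]
  have hr : ∑ k ∈ (Finset.univ.erase i).erase j, (k : ℕ) * (a ∘ Equiv.swap i j) k =
      ∑ k ∈ (Finset.univ.erase i).erase j, (k : ℕ) * a k := by
    refine Finset.sum_congr rfl fun k hk => ?_
    simp only [Finset.mem_erase, Finset.mem_univ, and_true] at hk
    rw [Function.comp_apply, Equiv.swap_apply_of_ne_of_ne hk.2 hk.1]
  rw [hr]
  simp only [Function.comp_apply, Equiv.swap_apply_left, Equiv.swap_apply_right]
  have hij' : (i : ℕ) < j := hij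
  nlinarith

/-- Let `k` be the first place of disagreement, so `a k < b k`, and let `j` be the next position
whose part lies in `(a k, b k]`. Choosing the first such `j` ensures that the swap does not
overshoot `b`. -/
theorem Dominates.exists_swap {a b : Fin n → ℕ} (h : Dominates b a) (hne : b ≠ a) :
    ∃ i j : Fin n, i < j ∧ a i < a j ∧ Dominates b (a ∘ Equiv.swap i j) := by
  obtain ⟨k, hk, hmin⟩ : ∃ k, a k ≠ b k ∧ ∀ i : Fin n, (i : ℕ) < k → a i = b i := by
    have hex : (Finset.univ.filter fun k => a k ≠ b k).Nonempty := by
      rw [Finset.filter_nonempty_iff]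
      by_contra hcon
      push Not at hcon
      exact hne (funext fun k => (hcon k (Finset.mem_univ _)).symm)
    refine ⟨_, (Finset.mem_filter.1 (Finset.min'_mem _ hex)).2, fun i hi => ?_⟩
    by_contra hcon
    exact absurd (Finset.min'_le _ i (Finset.mem_filter.2 ⟨Finset.mem_univ _, hcon⟩))
      (not_le.2 hi)
  have hlt : a k < b k := by
    have h1 := h.le (k + 1) (a k)
    rw [countGE_succ, countGE_succ, if_pos le_rfl, countGE_congr hmin] at h1
    split_ifs at h1 <;> omega
  have hb : ∀ p, (k : ℕ) < p → ∀ m ≤ b k, countIco a k m (b k + 1) + 1 ≤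
      countIco b p m (b k + 1) := by
    intro p hp m hm
    rw [countIco_congr hmin]
    unfold countIco
    rw [← Finset.card_insert_of_notMem (a := k) (by simp)]
    refine Finset.card_le_card fun i => ?_
    simp only [Finset.mem_filter, Finset.mem_univ, true_and, Finset.mem_insert]
    rintro (h1 | h1)
    · subst h1; omega
    · omega
  -- Otherwise `b` would have more parts than `a` in `(a k, b k]`, although the two are
  -- rearrangements of each other.
  have hex : (Finset.univ.filter fun j => k < j ∧ a k < a j ∧ a j ≤ b k).Nonempty := by
    rw [Finset.filter_nonempty_iff]
    by_contra hcon
    push Not at hcon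
    have h1 := hb n k.2 (a k + 1) hlt
    have h2 := h.eq (a k + 1)
    rw [countGE_eq_add a n (show a k + 1 ≤ b k + 1 by omega),
      countGE_eq_add b n (show a k + 1 ≤ b k + 1 by omega), h.eq] at h2
    have h3 : countIco a n (a k + 1) (b k + 1) ≤ countIco a k (a k + 1) (b k + 1) := by
      refine Finset.card_le_card fun i => ?_
      simp only [Finset.mem_filter, Finset.mem_univ, true_and]
      rintro ⟨h4, h5, h6⟩
      refine ⟨?_, h5, h6⟩
      by_contra h7
      rcases (not_lt.1 h7).eq_or_lt with h8 | h8
      · rw [← Fin.ext_iff] at h8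
        subst h8
        omega
      · have := hcon i (Finset.mem_univ _) h8 (by omega)
        omega
    omega
  obtain ⟨j, hj, hjmin⟩ : ∃ j, (k < j ∧ a k < a j ∧ a j ≤ b k) ∧
      ∀ i, k < i → i < j → a k < a i → b k < a i := by
    refine ⟨_, (Finset.mem_filter.1 (Finset.min'_mem _ hex)).2, fun i hi hij hai => ?_⟩
    by_contra hcon
    exact absurd (Finset.min'_le _ i (Finset.mem_filter.2
      ⟨Finset.mem_univ _, hi, hai, not_lt.1 hcon⟩)) (not_le.2 hij)
  obtain ⟨hkj, hakj, hjb⟩ := hj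
  have hkj' : (k : ℕ) < j := hkj
  refine ⟨k, j, hkj, hakj, fun p m => ?_, fun m => ?_⟩
  · by_cases hp : (k : ℕ) < p ↔ (j : ℕ) < p
    · rw [countGE_comp_swap a hp]
      exact h.le p m
    · have hkp : (k : ℕ) < p ∧ p ≤ j := by omega
      -- Only these counts of `a` grow, by one. Between `k` and `j` there are no parts of `a` in
      -- `[m, b k]`, while `b` has the extra part `b k` there, which makes up for it.
      by_cases hm : a k < m ∧ m ≤ a j
      · have h1 : countGE (a ∘ Equiv.swap k j) p m ≤ countGE a p m + 1 := by
          unfold countGE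
          refine le_trans (Finset.card_le_card fun x => ?_) (Finset.card_insert_le k _)
          simp only [Finset.mem_filter, Finset.mem_univ, true_and, Function.comp_apply,
            Finset.mem_insert]
          rw [Equiv.swap_apply_def]
          split_ifs <;> subst_vars <;> omega
        have h2 : countIco a p m (b k + 1) ≤ countIco a k m (b k + 1) := by
          refine Finset.card_le_card fun i => ?_
          simp only [Finset.mem_filter, Finset.mem_univ, true_and]
          rintro ⟨h4, h5, h6⟩
          refine ⟨?_, h5, h6⟩
          by_contra h7
          rcases (not_lt.1 h7).eq_or_lt with h8 | h8
          · rw [← Fin.ext_iff] at h8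
            subst h8
            omega
          · have := hjmin i h8 (by rw [Fin.lt_def]; omega) (by omega)
            omega
        have h3 := hb p hkp.1 m (by omega)
        have h4 := h.le p (b k + 1)
        rw [countGE_eq_add a p (show m ≤ b k + 1 by omega)] at h1
        rw [countGE_eq_add b p (show m ≤ b k + 1 by omega)]
        omega
      · refine le_trans (Finset.card_le_card fun x => ?_) (h.le p m)
        simp only [Finset.mem_filter, Finset.mem_univ, true_and, Function.comp_apply]
        rw [Equiv.swap_apply_def]
        split_ifs <;> subst_vars <;> omega
  · rw [countGE_comp_swap a (by simp)]
    exact h.eq m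

theorem mem_lswap_iff_dominates {a b : Fin n → ℕ} : b ∈ lswap a ↔ Dominates b a := by
  refine ⟨dominates_of_mem_lswap, fun h => ?_⟩
  induction hm : moment a using Nat.strong_induction_on generalizing a with
  | _ l ih =>
  by_cases hne : b = a
  · rw [hne]
    exact Relation.ReflTransGen.refl
  · obtain ⟨i, j, hij, hlt, hd⟩ := h.exists_swap hne
    exact Relation.ReflTransGen.head ⟨i, j, hij, hlt.le, rfl⟩
      (ih _ (hm ▸ moment_comp_swap_lt a hij hlt) hd rfl)

theorem moment_lt_of_mem_lswap {a b : Fin n → ℕ} (h : b ∈ lswap a) (hne : b ≠ a) :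
    moment b < moment a := by
  induction h with
  | refl => exact absurd rfl hne
  | @tail c b _ h ih =>
    obtain ⟨i, j, hij, hle, rfl⟩ := h
    rcases hle.eq_or_lt with he | hlt
    · have hc : c ∘ Equiv.swap i j = c := by
        funext x
        rw [Function.comp_apply, Equiv.swap_apply_def]
        split_ifs <;> subst_vars <;> simp [he]
      rw [hc] at hne ⊢
      exact ih hne
    · by_cases hca : c = a
      · rw [hca] at hlt ⊢
        exact moment_comp_swap_lt a hij hlt
      · exact (moment_comp_swap_lt c hij hlt).trans (ih hca)

/-! #### Adjacent swaps -/

theorem coe_next {i : Fin n} (h : i ≠ next i) : ((next i : Fin n) : ℕ) = i + 1 := by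
  unfold next at h ⊢
  split_ifs at h ⊢ with h1
  · rfl
  · exact absurd rfl h

theorem countGE_succ_succ (a : Fin n → ℕ) {i : Fin n} (h : i ≠ next i) (m : ℕ) :
    countGE a (i + 2) m = countGE a i m + (if m ≤ a i then 1 else 0) +
      if m ≤ a (next i) then 1 else 0 := by
  have := countGE_succ a (next i) m
  rwa [coe_next h, countGE_succ] at this

theorem countGE_comp_swap_next (a : Fin n → ℕ) {i : Fin n} (h : i ≠ next i) {k : ℕ}
    (hk : k ≠ i + 1) (m : ℕ) : countGE (a ∘ Equiv.swap i (next i)) k m = countGE a k m :=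
  countGE_comp_swap a (by rw [coe_next h]; omega) m

theorem countGE_comp_swap_next_succ (a : Fin n → ℕ) {i : Fin n} (h : i ≠ next i) (m : ℕ) :
    countGE (a ∘ Equiv.swap i (next i)) (i + 1) m =
      countGE a i m + if m ≤ a (next i) then 1 else 0 := by
  rw [countGE_succ, countGE_comp_swap_next a h (by omega), Function.comp_apply,
    Equiv.swap_apply_left]

/-- Lifting property: only the prefix of length `i + 1` changes, and its count is controlled by
those of lengths `i` and `i + 2`. -/
theorem lswap_comp_swap_next {a b : Fin n → ℕ} {i : Fin n} (hi : a i < a (next i))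
    (hb : b ∈ lswap a) : b ∘ Equiv.swap i (next i) ∈ lswap a := by
  have hne : i ≠ next i := fun e => by rw [← e] at hi; exact lt_irrefl _ hi
  rw [mem_lswap_iff_dominates] at hb ⊢
  have hne' : n ≠ i + 1 := by have := (next i).2; rw [coe_next hne] at this; omega
  refine ⟨fun k m => ?_, fun m => by rw [countGE_comp_swap_next b hne hne', hb.eq]⟩
  by_cases hk : k = i + 1
  · subst hk
    rw [countGE_comp_swap_next_succ b hne, countGE_succ]
    have h1 := hb.le i m
    have h2 := hb.le (i + 2) m
    rw [countGE_succ_succ a hne, countGE_succ_succ b hne] at h2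
    split_ifs at h2 ⊢ <;> omega
  · rw [countGE_comp_swap_next b hne hk]
    exact hb.le k m

theorem mem_lswap_comp_swap_next {a b : Fin n → ℕ} {i : Fin n} (hi : a i < a (next i))
    (hb : b ∈ lswap a) (hbi : b (next i) ≤ b i) : b ∈ lswap (a ∘ Equiv.swap i (next i)) := by
  have hne : i ≠ next i := fun e => by rw [← e] at hi; exact lt_irrefl _ hi
  rw [mem_lswap_iff_dominates] at hb ⊢
  have hne' : n ≠ i + 1 := by have := (next i).2; rw [coe_next hne] at this; omega
  refine ⟨fun k m => ?_, fun m => by rw [countGE_comp_swap_next a hne hne', hb.eq]⟩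
  by_cases hk : k = i + 1
  · subst hk
    rw [countGE_comp_swap_next_succ a hne, countGE_succ]
    have h1 := hb.le i m
    have h2 := hb.le (i + 2) m
    rw [countGE_succ_succ a hne, countGE_succ_succ b hne] at h2
    split_ifs at h2 ⊢ <;> omega
  · rw [countGE_comp_swap_next a hne hk]
    exact hb.le k m

theorem lswap_subset_of_ascent {a : Fin n → ℕ} {i : Fin n} (hi : a i < a (next i)) :
    lswap (a ∘ Equiv.swap i (next i)) ⊆ lswap a := by
  have hne : i ≠ next i := fun e => by rw [← e] at hi; exact lt_irrefl _ hi
  refine fun b hb => Relation.ReflTransGen.head ⟨i, next i, ?_, hi.le, rfl⟩ hb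
  rw [Fin.lt_def, coe_next hne]
  omega

end Dominance

section Correspondence

variable {n : ℕ}

/-! ### Removing a box and dominance -/

/-- Shortening a part from `s` to `s - 1` is visible only at the threshold `s`, in prefixes
containing that part. -/
theorem countGE_eq_update (a : Fin n → ℕ) {q : Fin n} {s : ℕ} (hq : a q = s) (hs : 0 < s)
    (k m : ℕ) : countGE a k m =
      countGE (Function.update a q (s - 1)) k m + if m = s ∧ (q : ℕ) < k then 1 else 0 := by
  unfold countGE
  split_ifs with h
  · rw [← Finset.card_insert_of_notMem (a := q) (by simp; omega)]
    congr 1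
    ext i
    simp only [Finset.mem_filter, Finset.mem_univ, true_and, Finset.mem_insert,
      Function.update_apply]
    split_ifs with hi
    · subst hi; omega
    · simp [hi]
  · rw [add_zero]
    congr 1
    ext i
    simp only [Finset.mem_filter, Finset.mem_univ, true_and, Function.update_apply]
    split_ifs with hi
    · subst hi; omega
    · rfl

theorem countGE_anti (a : Fin n → ℕ) (k m : ℕ) : countGE a k (m + 1) ≤ countGE a k m :=
  Finset.card_le_card fun i => by
    simp only [Finset.mem_filter, Finset.mem_univ, true_and]
    omega

theorem countGE_eq_succ {a : Fin n → ℕ} {k m : ℕ} (h : ∀ i : Fin n, (i : ℕ) < k → a i ≠ m) :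
    countGE a k m = countGE a k (m + 1) := by
  unfold countGE
  congr 1
  ext i
  have := h i
  simp only [Finset.mem_filter, Finset.mem_univ, true_and]
  omega

theorem Dominates.exists_part {a b : Fin n → ℕ} (h : Dominates b a) {p : Fin n} :
    ∃ q, a q = b p := by
  by_contra hcon
  push Not at hcon
  have h1 : countGE a n (b p) = countGE a n (b p + 1) := countGE_eq_succ fun i _ => hcon i
  rw [h.eq, h.eq, countGE_eq_add b n (Nat.le_succ (b p))] at h1
  have h2 : 0 < countIco b n (b p) (b p + 1) :=
    Finset.card_pos.2 ⟨p, by simp⟩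
  have : countGE b n (b p).succ = countGE b n (b p + 1) := rfl
  have : countIco b n (b p) (b p).succ = countIco b n (b p) (b p + 1) := rfl
  omega

theorem Dominates.exists_part' {a b : Fin n → ℕ} (h : Dominates b a) {q : Fin n} :
    ∃ p, b p = a q := by
  by_contra hcon
  push Not at hcon
  have h1 : countGE b n (a q) = countGE b n (a q + 1) := countGE_eq_succ fun i _ => hcon i
  rw [← h.eq, ← h.eq, countGE_eq_add a n (Nat.le_succ (a q))] at h1
  have h2 : 0 < countIco a n (a q) (a q + 1) :=
    Finset.card_pos.2 ⟨q, by simp⟩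
  have : countGE a n (a q).succ = countGE a n (a q + 1) := rfl
  have : countIco a n (a q) (a q).succ = countIco a n (a q) (a q + 1) := rfl
  omega

/-- The critical counts are those at threshold `s` for prefixes containing `q` but not `p`. For `s >
1`, `b` has no part `s - 1` in such a prefix, so its count at `s` equals that at `s - 1`, where
dominance is known. For `s = 1` the parts of `b` at positions `i` of the prefix with `k ≤ i + 1` are
all positive, and the other parts of `a` vanish. -/
theorem Dominates.of_update {a b : Fin n → ℕ} {p q : Fin n} {s k : ℕ} (hs : 0 < s) (hq : a q = s)
    (hp : b p = s) (hmin : ∀ i < p, k ≤ i + 1 → b i ≠ s - 1)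
    (ha : ∀ i : Fin n, (i : ℕ) + 1 < k → a i = 0) (hb : ∀ i : Fin n, (i : ℕ) + 1 < k → b i = 0)
    (h : Dominates (Function.update b p (s - 1)) (Function.update a q (s - 1))) :
    Dominates b a := by
  refine ⟨fun j m => ?_, fun m => ?_⟩
  · by_cases hm : m = s ∧ (q : ℕ) < j ∧ j ≤ p
    · obtain ⟨rfl, -, hjp⟩ := hm
      rcases Nat.eq_or_lt_of_le hs with h1 | h1
      · refine Finset.card_le_card fun i => ?_
        simp only [Finset.mem_filter, Finset.mem_univ, true_and]
        rintro ⟨h2, h3⟩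
        refine ⟨h2, ?_⟩
        by_contra h4
        refine hmin i (Fin.lt_def.2 (by omega)) ?_ (by omega)
        by_contra h5
        have := ha i (by omega)
        omega
      · have h2 : countGE b j (m - 1) = countGE b j m := by
          rw [countGE_eq_succ, Nat.sub_add_cancel hs]
          intro i hi hbi
          by_cases hk : k ≤ i + 1
          · exact hmin i (Fin.lt_def.2 (by omega)) hk hbi
          · have := hb i (by omega)
            omega
        have h3 := h.le j (m - 1)
        have h4 := countGE_eq_update a hq hs j (m - 1)
        have h5 := countGE_eq_update b hp hs j (m - 1)
        have h6 := countGE_anti a j (m - 1)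
        rw [Nat.sub_add_cancel hs] at h6
        rw [if_neg (by omega)] at h4 h5
        omega
    · have := h.le j m
      rw [countGE_eq_update a hq hs, countGE_eq_update b hp hs]
      split_ifs <;> omega
  · rw [countGE_eq_update a hq hs, countGE_eq_update b hp hs, h.eq]
    simp

/-- The critical prefixes contain `p` but not `q`. As `a` has no part `s` there, its count at `s`
equals that at `s + 1`, where the deletion has no effect. -/
theorem Dominates.update {a b : Fin n → ℕ} {p q : Fin n} {s : ℕ} (hs : 0 < s) (hq : a q = s)
    (hp : b p = s) (hmin : ∀ i < q, a i ≠ s) (h : Dominates b a) :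
    Dominates (Function.update b p (s - 1)) (Function.update a q (s - 1)) := by
  refine ⟨fun j m => ?_, fun m => ?_⟩
  · have ha := countGE_eq_update a hq hs j m
    have hb := countGE_eq_update b hp hs j m
    have hab := h.le j m
    by_cases hm : m = s ∧ (p : ℕ) < j ∧ j ≤ q
    · obtain ⟨rfl, -, hjq⟩ := hm
      rw [if_neg (by omega)] at ha
      have h1 : countGE a j m = countGE a j (m + 1) :=
        countGE_eq_succ fun i hi => hmin i (Fin.lt_def.2 (by omega))
      have h2 := h.le j (m + 1)
      have h3 := countGE_eq_update b hp hs j (m + 1)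
      rw [if_neg (by omega)] at h3
      have h4 := countGE_anti (Function.update b p (m - 1)) j m
      omega
    · split_ifs at ha hb <;> omega
  · have ha := countGE_eq_update a hq hs n m
    have hb := countGE_eq_update b hp hs n m
    have hab := h.eq m
    simp only [Fin.is_lt, and_true] at ha hb
    omega

/-! ### Fillings with the same columns -/

/-- The columns of `G` and `H` contain the same positive entries. -/
def SameColumns (G H : Fin n → ℕ → ℕ) : Prop :=
  ∀ c x, 0 < x → ((∃ i, G i c = x) ↔ ∃ i, H i c = x)

theorem SameColumns.symm {G H : Fin n → ℕ → ℕ} (h : SameColumns G H) : SameColumns H G :=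
  fun c x hx => (h c x hx).symm

theorem SameColumns.trans {G H K : Fin n → ℕ → ℕ} (h : SameColumns G H) (h' : SameColumns H K) :
    SameColumns G K :=
  fun c x hx => (h c x hx).trans (h' c x hx)

theorem SameColumns.forall {G H : Fin n → ℕ → ℕ} (h : SameColumns G H) {c : ℕ} {P : ℕ → Prop}
    (hP : ∀ i, G i c ≠ 0 → P (G i c)) (i : Fin n) (hi : H i c ≠ 0) : P (H i c) := by
  obtain ⟨j, hj⟩ := (h c (H i c) (Nat.pos_of_ne_zero hi)).2 ⟨i, rfl⟩
  rw [← hj] at hi ⊢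
  exact hP j hi

theorem IsLastMin.congr {G H : Fin n → ℕ → ℕ} (h : SameColumns G H) {k s : ℕ}
    (hm : IsLastMin G k s) : IsLastMin H k s :=
  ⟨hm.pos, hm.column_pos, fun i c hc => h.forall (P := fun x => k ≤ x) (fun j => hm.le j c hc) i,
    fun i c hc => h.forall (P := fun x => k < x) (fun j => hm.lt j c hc) i⟩

theorem SameColumns.insert {G H : Fin n → ℕ → ℕ} (h : SameColumns G H) {p q : Fin n} {s : ℕ}
    (k : ℕ) (hq : G q s = 0) (hp : H p s = 0) :
    SameColumns (setEntry G q s k) (setEntry H p s k) := by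
  have key : ∀ (G : Fin n → ℕ → ℕ) (q : Fin n), G q s = 0 → ∀ c x, 0 < x →
      ((∃ i, setEntry G q s k i c = x) ↔ (c = s ∧ k = x) ∨ ∃ i, G i c = x) := by
    intro G q hq c x hx
    constructor
    · rintro ⟨i, hi⟩
      simp only [setEntry] at hi
      split_ifs at hi with h1
      · exact Or.inl ⟨h1.2, hi⟩
      · exact Or.inr ⟨i, hi⟩
    · rintro (⟨rfl, rfl⟩ | ⟨i, hi⟩)
      · exact ⟨q, by simp [setEntry]⟩
      · refine ⟨i, ?_⟩
        simp only [setEntry]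
        rw [if_neg, hi]
        rintro ⟨rfl, rfl⟩
        omega
  intro c x hx
  rw [key G q hq c x hx, key H p hp c x hx, h c x hx]

theorem SameColumns.remove {G H : Fin n → ℕ → ℕ} (h : SameColumns G H) {p q : Fin n} {s k : ℕ}
    (hq : ∀ i, G i s = k ↔ i = q) (hp : ∀ i, H i s = k ↔ i = p) :
    SameColumns (setEntry G q s 0) (setEntry H p s 0) := by
  have key : ∀ (G : Fin n → ℕ → ℕ) (q : Fin n), (∀ i, G i s = k ↔ i = q) → ∀ c x, 0 < x →
      ((∃ i, setEntry G q s 0 i c = x) ↔ ¬ (c = s ∧ k = x) ∧ ∃ i, G i c = x) := by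
    intro G q hq c x hx
    constructor
    · rintro ⟨i, hi⟩
      simp only [setEntry] at hi
      split_ifs at hi with h1
      · omega
      · refine ⟨?_, i, hi⟩
        rintro ⟨rfl, rfl⟩
        exact h1 ⟨(hq i).1 hi, rfl⟩
    · rintro ⟨h1, i, hi⟩
      refine ⟨i, ?_⟩
      simp only [setEntry]
      rw [if_neg, hi]
      rintro ⟨rfl, rfl⟩
      exact h1 ⟨rfl, ((hq i).2 rfl).symm.trans hi⟩
  intro c x hx
  rw [key G q hq c x hx, key H p hp c x hx, h c x hx]

theorem setEntry_setEntry_zero {G : Fin n → ℕ → ℕ} {q : Fin n} {s k : ℕ} (hq : G q s = k) :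
    setEntry (setEntry G q s 0) q s k = G := by
  funext i c
  simp only [setEntry]
  split_ifs with h
  · rw [h.1, h.2, hq]
  · rfl

theorem update_update_pred (b : Fin n → ℕ) {p : Fin n} {s : ℕ} (hp : b p = s - 1) :
    Function.update (Function.update b p s) p (s - 1) = b := by
  rw [Function.update_idem, ← hp, Function.update_eq_self]

/-! ### Existence and uniqueness of fillings with prescribed column sets. -/

namespace AnchorFilling

variable {d : Fin n → ℕ} {G : Fin n → ℕ → ℕ} {r r' : Fin n → Fin n → Prop} {k s : ℕ} {p : Fin n}

theorem of_eq_zero (h : AnchorFilling r d G) (hd : d = 0) : AnchorFilling r' d G where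
  basement := h.basement
  pos := h.pos
  zero := h.zero
  row := h.row
  column := h.column
  long := fun i j _ _ c hc => by simp [hd] at hc
  short := fun i j _ hij => by simp [hd] at hij

theorem eq_zero_iff (h : AnchorFilling r d G) : d = 0 ↔ ∀ i c, 0 < c → G i c = 0 := by
  constructor
  · rintro rfl i c hc
    exact h.zero i c hc
  · intro h1
    funext i
    by_contra h2
    exact (h.pos i 1 (Nat.one_le_iff_ne_zero.2 h2)).ne' (h1 i 1 one_pos)

theorem exists_isLastMin (h : AnchorFilling r d G) (hd : d ≠ 0) :
    ∃ k s, IsLastMin G k s ∧ ∃ p, G p s = k := by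
  classical
  have hex : ∃ k, 0 < k ∧ ∃ i c, 0 < c ∧ G i c = k := by
    rw [ne_eq, h.eq_zero_iff] at hd
    push Not at hd
    obtain ⟨i, c, hc, hne⟩ := hd
    exact ⟨_, Nat.pos_of_ne_zero hne, i, c, hc, rfl⟩
  obtain ⟨hk, i, c, hc, hic⟩ := Nat.find_spec hex
  have hkmin := fun m => Nat.find_min' hex (m := m)
  set k := Nat.find hex
  let P : ℕ → Prop := fun c => ∃ i, G i c = k
  have hbd : ∀ c, P c → c ≤ ∑ i, d i := by
    rintro c ⟨i, hi⟩
    exact ((h.ne_zero_iff i c).1 (by omega)).trans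
      (Finset.single_le_sum (f := d) (fun _ _ => Nat.zero_le _) (Finset.mem_univ i))
  have hPc : P c := ⟨i, hic⟩
  have hcs := Nat.le_findGreatest (hbd c hPc) hPc
  have hle : ∀ i c, 0 < c → G i c ≠ 0 → k ≤ G i c := fun i c hc hne =>
    hkmin _ ⟨Nat.pos_of_ne_zero hne, i, c, hc, rfl⟩
  -- The total number of boxes bounds every column that contains `k`, so the last such column can be
  -- searched for below it.
  refine ⟨k, Nat.findGreatest P (∑ i, d i), ⟨hk, hc.trans_le hcs, hle, fun i c hc hne => ?_⟩,
    Nat.findGreatest_spec (hbd c hPc) hPc⟩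
  refine lt_of_le_of_ne (hle i c (by omega) hne) fun he => ?_
  have hP : P c := ⟨i, he.symm⟩
  exact absurd (Nat.le_findGreatest (hbd c hP) hP) (not_le.2 hc)

theorem eq_min_iff (h : AnchorFilling r d G) (hk : 0 < k) (hp : G p s = k) (i : Fin n) :
    G i s = k ↔ i = p := by
  constructor
  · intro hi
    by_contra hne
    exact h.column i p s hne ((h.ne_zero_iff i s).1 (by omega)) ((h.ne_zero_iff p s).1 (by omega))
      (hi.trans hp.symm)
  · rintro rfl
    exact hp

theorem remove_le (hm : IsLastMin G k s) (i : Fin n) (c : ℕ) (hc : 0 < c)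
    (hne : setEntry G p s 0 i c ≠ 0) : k ≤ setEntry G p s 0 i c := by
  simp only [setEntry] at hne ⊢
  split_ifs at hne ⊢ with h1
  · exact absurd rfl hne
  · exact hm.le i c hc hne

theorem remove_lt (h : AnchorFilling r d G) (hm : IsLastMin G k s) (hp : G p s = k) (i : Fin n)
    (c : ℕ) (hc : s ≤ c) (hne : setEntry G p s 0 i c ≠ 0) : k < setEntry G p s 0 i c := by
  simp only [setEntry] at hne ⊢
  split_ifs at hne ⊢ with h1
  · exact absurd rfl hne
  · rcases hc.eq_or_lt with rfl | hc
    · refine lt_of_le_of_ne (hm.le i s hm.column_pos hne) fun he => ?_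
      exact h1 ⟨(h.eq_min_iff hm.pos hp i).1 he.symm, rfl⟩
    · exact hm.lt i c hc hne

theorem eq_zero_of_lt (h : AnchorFilling r d G) (hle : ∀ i c, 0 < c → G i c ≠ 0 → k ≤ G i c)
    (i : Fin n) (hi : (i : ℕ) + 1 < k) : d i = 0 := by
  by_contra hne
  have h1 := h.pos i 1 (by omega)
  have h2 := hle i 1 one_pos h1.ne'
  have h3 := h.le_basement i 1
  omega

theorem sum_update_lt {d : Fin n → ℕ} (hs : 0 < s) (hd : d p = s) :
    ∑ i, Function.update d p (s - 1) i < ∑ i, d i := by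
  refine Finset.sum_lt_sum (fun i _ => ?_) ⟨p, Finset.mem_univ _, ?_⟩
  · rw [Function.update_apply]
    split_ifs with h
    · rw [h]; omega
    · exact le_rfl
  · rw [Function.update_self]; omega

/-- Delete the last minimal entry from the key filling, convert the rest by induction, and reinsert
the entry in the atom filling at the first admissible row of length `s - 1`. -/
theorem exists_atom {a : Fin n → ℕ} (h : AnchorFilling (· > ·) a G) :
    ∃ b H, Dominates b a ∧ AnchorFilling (· < ·) b H ∧ SameColumns G H := by
  induction hN : ∑ i, a i using Nat.strong_induction_on generalizing a G with
  | _ N ih =>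
  by_cases ha : a = 0
  · exact ⟨a, G, Dominates.refl a, h.of_eq_zero ha, fun _ _ _ => Iff.rfl⟩
  obtain ⟨k, s, hm, q, hq⟩ := h.exists_isLastMin ha
  have haq := h.length_eq hm hq
  have hs := hm.column_pos
  obtain ⟨b, H, hdom, hH, hcol⟩ := ih _ (hN ▸ sum_update_lt hs haq) (h.key_remove hm hq) rfl
  have hle : ∀ i c, 0 < c → H i c ≠ 0 → k ≤ H i c := fun i c hc =>
    hcol.forall (P := fun x => k ≤ x) (fun j => remove_le hm j c hc) i
  have hlt : ∀ i c, s ≤ c → H i c ≠ 0 → k < H i c := fun i c hc =>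
    hcol.forall (P := fun x => k < x) (fun j => h.remove_lt hm hq j c hc) i
  have hkq : k ≤ q + 1 := hq ▸ h.le_basement q s
  have hex : (Finset.univ.filter fun p : Fin n => k ≤ p + 1 ∧ b p = s - 1).Nonempty := by
    rw [Finset.filter_nonempty_iff]
    -- If `s = 1`, row number `k` is empty, since its first entry would be `k`. If `s > 1`, some
    -- part of `b` equals `s - 1`, and a nonempty row has index number at least `k`.
    rcases Nat.eq_or_lt_of_le (Nat.one_le_iff_ne_zero.2 hs.ne') with h1 | h1
    · have hkpos := hm.pos
      refine ⟨⟨k - 1, by have := q.2; omega⟩, Finset.mem_univ _, by simp only; omega, ?_⟩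
      by_contra hne
      have h2 := hH.eq_of_column_one ⟨k - 1, by have := q.2; omega⟩ (by omega)
      have h3 := hlt ⟨k - 1, by have := q.2; omega⟩ 1 h1.ge (by rw [h2]; omega)
      rw [h2] at h3
      simp only at h3
      omega
    · obtain ⟨p, hp⟩ := hdom.exists_part' (q := q)
      rw [Function.update_self] at hp
      refine ⟨p, Finset.mem_univ _, ?_, hp⟩
      by_contra hne
      have := hH.eq_zero_of_lt hle p (by omega)
      omega
  obtain ⟨p, ⟨hkp, hp⟩, hpmin⟩ : ∃ p : Fin n, (k ≤ p + 1 ∧ b p = s - 1) ∧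
      ∀ i < p, k ≤ i + 1 → b i ≠ s - 1 := by
    refine ⟨_, (Finset.mem_filter.1 (Finset.min'_mem _ hex)).2, fun i hi hk hbi => ?_⟩
    exact absurd (Finset.min'_le _ i (Finset.mem_filter.2 ⟨Finset.mem_univ _, hk, hbi⟩))
      (not_le.2 hi)
  have hup := update_update_pred b hp
  have hmin' : ∀ i < p, k ≤ i + 1 → Function.update b p s i ≠ s - 1 := by
    intro i hi hk
    rw [Function.update_of_ne hi.ne]
    exact hpmin i hi hk
  refine ⟨Function.update b p s, setEntry H p s k, ?_, ?_, ?_⟩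
  · refine Dominates.of_update hs haq (Function.update_self p s b) hmin'
      (h.eq_zero_of_lt hm.le) (fun i hi => ?_) (hup.symm ▸ hdom)
    rw [Function.update_of_ne (by rintro rfl; omega)]
    exact hH.eq_zero_of_lt hle i hi
  · exact atom_insert (hup.symm ▸ hH) (Function.update_self p s b) hs hm.pos hkp hmin' hle hlt
  · rw [← setEntry_setEntry_zero hq]
    exact hcol.insert k (by simp [setEntry]) (hH.zero p s (by omega))

theorem exists_key {a b : Fin n → ℕ} {H : Fin n → ℕ → ℕ} (h : AnchorFilling (· < ·) b H)
    (hdom : Dominates b a) : ∃ G, AnchorFilling (· > ·) a G ∧ SameColumns G H := by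
  induction hN : ∑ i, b i using Nat.strong_induction_on generalizing a b H with
  | _ N ih =>
  by_cases hb : b = 0
  · have ha : a = b := by
      funext q
      obtain ⟨p, hp⟩ := hdom.exists_part' (q := q)
      rw [← hp, hb]
      rfl
    exact ⟨H, ha ▸ h.of_eq_zero hb, fun _ _ _ => Iff.rfl⟩
  obtain ⟨k, s, hm, p, hp⟩ := h.exists_isLastMin hb
  have hbp := h.length_eq hm hp
  have hs := hm.column_pos
  have hex : (Finset.univ.filter fun q : Fin n => a q = s).Nonempty := by
    rw [Finset.filter_nonempty_iff]
    obtain ⟨q, hq⟩ := hdom.exists_part (p := p)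
    exact ⟨q, Finset.mem_univ _, hq.trans hbp⟩
  obtain ⟨q, hq, hqmin⟩ : ∃ q : Fin n, a q = s ∧ ∀ i < q, a i ≠ s := by
    refine ⟨_, (Finset.mem_filter.1 (Finset.min'_mem _ hex)).2, fun i hi hai => ?_⟩
    exact absurd (Finset.min'_le _ i (Finset.mem_filter.2 ⟨Finset.mem_univ _, hai⟩)) (not_le.2 hi)
  obtain ⟨G, hG, hcol⟩ := ih _ (hN ▸ sum_update_lt hs hbp) (h.atom_remove hm hp)
    (hdom.update hs hq hbp hqmin) rfl
  have hle : ∀ i c, 0 < c → G i c ≠ 0 → k ≤ G i c := fun i c hc =>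
    hcol.symm.forall (P := fun x => k ≤ x) (fun j => remove_le hm j c hc) i
  have hlt : ∀ i c, s ≤ c → G i c ≠ 0 → k < G i c := fun i c hc =>
    hcol.symm.forall (P := fun x => k < x) (fun j => h.remove_lt hm hp j c hc) i
  -- Rows of `b` with number below `k` are empty, so by dominance the same is true of `a`.
  have hkq : k ≤ q + 1 := by
    by_contra hcon
    have h1 := hdom.le (q + 1) 1
    have h2 : countGE b (q + 1) 1 = 0 := by
      rw [countGE, Finset.card_eq_zero, Finset.filter_eq_empty_iff]
      intro i _ hi
      have := h.eq_zero_of_lt hm.le i (by omega)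
      omega
    have h3 : 0 < countGE a (q + 1) 1 := Finset.card_pos.2 ⟨q, by simp; omega⟩
    omega
  refine ⟨setEntry G q s k, key_insert hG hq hs hm.pos hkq hqmin hle hlt, ?_⟩
  rw [← setEntry_setEntry_zero hp]
  exact hcol.insert k (hG.zero q s (by rw [Function.update_self]; omega)) (by simp [setEntry])

theorem key_unique {a : Fin n → ℕ} {G' : Fin n → ℕ → ℕ} (h : AnchorFilling (· > ·) a G)
    (h' : AnchorFilling (· > ·) a G') (hcol : SameColumns G G') : G = G' := by
  induction hN : ∑ i, a i using Nat.strong_induction_on generalizing a G G' with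
  | _ N ih =>
  by_cases ha : a = 0
  · funext i c
    rcases Nat.eq_zero_or_pos c with rfl | hc
    · rw [h.basement, h'.basement]
    · rw [h.eq_zero_iff.1 ha i c hc, h'.eq_zero_iff.1 ha i c hc]
  obtain ⟨k, s, hm, q, hq⟩ := h.exists_isLastMin ha
  have hm' := hm.congr hcol
  obtain ⟨q', hq'⟩ := (hcol s k hm.pos).1 ⟨q, hq⟩
  have haq := h.length_eq hm hq
  have hqq : q = q' := by
    rcases lt_trichotomy q q' with hlt | he | hlt
    · exact absurd haq (h'.key_remove_length_ne hm' hq' q hlt)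
    · exact he
    · exact absurd (h'.length_eq hm' hq') (h.key_remove_length_ne hm hq q' hlt)
  subst hqq
  rw [← setEntry_setEntry_zero hq, ← setEntry_setEntry_zero hq',
    ih _ (hN ▸ sum_update_lt hm.column_pos haq) (h.key_remove hm hq) (h'.key_remove hm' hq')
      (hcol.remove (h.eq_min_iff hm.pos hq) (h'.eq_min_iff hm.pos hq')) rfl]

/-- The shapes are not assumed equal. After deletion they agree by induction, and
`atom_remove_length_ne` recovers the row of the deleted box from the common smaller shape. -/
theorem atom_unique {b b' : Fin n → ℕ} {H H' : Fin n → ℕ → ℕ} (h : AnchorFilling (· < ·) b H)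
    (h' : AnchorFilling (· < ·) b' H') (hcol : SameColumns H H') : b = b' ∧ H = H' := by
  induction hN : ∑ i, b i using Nat.strong_induction_on generalizing b b' H H' with
  | _ N ih =>
  by_cases hb : b = 0
  · have hH := h.eq_zero_iff.1 hb
    have hH' : ∀ i c, 0 < c → H' i c = 0 := by
      intro i c hc
      by_contra hne
      obtain ⟨j, hj⟩ := (hcol c _ (Nat.pos_of_ne_zero hne)).2 ⟨i, rfl⟩
      exact hne (hj.symm.trans (hH j c hc))
    refine ⟨hb.trans (h'.eq_zero_iff.2 hH').symm, ?_⟩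
    funext i c
    rcases Nat.eq_zero_or_pos c with rfl | hc
    · rw [h.basement, h'.basement]
    · rw [hH i c hc, hH' i c hc]
  obtain ⟨k, s, hm, p, hp⟩ := h.exists_isLastMin hb
  have hm' := hm.congr hcol
  obtain ⟨p', hp'⟩ := (hcol s k hm.pos).1 ⟨p, hp⟩
  have hbp := h.length_eq hm hp
  have hbp' := h'.length_eq hm' hp'
  obtain ⟨hbb, hHH⟩ := ih _ (hN ▸ sum_update_lt hm.column_pos hbp) (h.atom_remove hm hp)
    (h'.atom_remove hm' hp')
    (hcol.remove (h.eq_min_iff hm.pos hp) (h'.eq_min_iff hm.pos hp')) rfl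
  have hkp : k ≤ p + 1 := hp ▸ h.le_basement p s
  have hkp' : k ≤ p' + 1 := hp' ▸ h'.le_basement p' s
  have hpp : p = p' := by
    rcases lt_trichotomy p p' with hlt | he | hlt
    · have := congrFun hbb p
      rw [Function.update_self, Function.update_of_ne hlt.ne] at this
      exact absurd this.symm (h'.atom_remove_length_ne hm' hp' p hlt hkp)
    · exact he
    · have := congrFun hbb p'
      rw [Function.update_self, Function.update_of_ne hlt.ne] at this
      exact absurd this (h.atom_remove_length_ne hm hp p' hlt hkp')
  subst hpp
  refine ⟨?_, by rw [← setEntry_setEntry_zero hp, ← setEntry_setEntry_zero hp', hHH]⟩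
  funext i
  by_cases hi : i = p
  · rw [hi, hbp, hbp']
  · simpa [hi] using congrFun hbb i

end AnchorFilling

end Correspondence

/-! ### Set-valued fillings and their anchors -/

section SetValued

variable {n : ℕ}

/-- The conditions on a set-valued filling of the diagram `d` other than the one on triples. -/
structure IsSetFilling (d : Fin n → ℕ) (F : Filling n) : Prop where
  filling : IsFilling d F
  columns : ColumnStrict F
  rows : RowDecreasing F
  free : FreeEntriesLow d F

/-- The array of anchors of `F`, with a basement column with entry `i + 1` in row `i`. -/
def anchors (F : Filling n) (i : Fin n) : ℕ → ℕ
  | 0 => i + 1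
  | c + 1 => anchor F i c

/-- The free entries in column `c`. -/
def freeColumn (F : Filling n) (c : ℕ) : Finset ℕ :=
  Finset.univ.biUnion fun i => (F i c).erase (anchor F i c)

theorem mem_freeColumn {F : Filling n} {c k : ℕ} :
    k ∈ freeColumn F c ↔ ∃ i, k ≠ anchor F i c ∧ k ∈ F i c := by
  simp [freeColumn]

theorem anchor_mem {F : Filling n} {i : Fin n} {c : ℕ} (h : (F i c).Nonempty) :
    anchor F i c ∈ F i c := by
  obtain ⟨x, hx, he⟩ := Finset.exists_mem_eq_sup _ h id
  rw [anchor, he]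
  exact hx

theorem le_anchor {F : Filling n} {i : Fin n} {c k : ℕ} (h : k ∈ F i c) : k ≤ anchor F i c :=
  Finset.le_sup (f := id) h

namespace IsSetFilling

variable {d d' : Fin n → ℕ} {F F' : Filling n}

theorem anchor_pos (h : IsSetFilling d F) {i : Fin n} {c : ℕ} (hc : c < d i) :
    0 < anchor F i c :=
  h.filling.2 i c _ (anchor_mem ((h.filling.1 i c).2 hc))

theorem eq_empty (h : IsSetFilling d F) {i : Fin n} {c : ℕ} (hc : d i ≤ c) : F i c = ∅ := by
  by_contra hne
  exact absurd ((h.filling.1 i c).1 (Finset.nonempty_iff_ne_empty.2 hne)) (not_lt.2 hc)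

theorem anchor_eq_zero (h : IsSetFilling d F) {i : Fin n} {c : ℕ} (hc : d i ≤ c) :
    anchor F i c = 0 := by
  rw [anchor, h.eq_empty hc]
  rfl

theorem lt_of_anchor_pos (h : IsSetFilling d F) {i : Fin n} {c : ℕ} (hc : 0 < anchor F i c) :
    c < d i := by
  by_contra hcon
  exact hc.ne' (h.anchor_eq_zero (not_lt.1 hcon))

theorem anchor_succ_le (h : IsSetFilling d F) {i : Fin n} {c k : ℕ} (hk : k ∈ F i c) :
    anchor F i (c + 1) ≤ k := by
  by_cases hc : c + 1 < d i
  · exact h.rows i c k hk _ (anchor_mem ((h.filling.1 i (c + 1)).2 hc))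
  · rw [h.anchor_eq_zero (not_lt.1 hc)]
    exact Nat.zero_le _

theorem row_eq_of_mem (h : IsSetFilling d F) {i j : Fin n} {c k : ℕ} (hi : k ∈ F i c)
    (hj : k ∈ F j c) : i = j := by
  by_contra hne
  exact Finset.disjoint_left.1 (h.columns c i j hne) hi hj

theorem anchor_mem_of_pos (h : IsSetFilling d F) {i : Fin n} {c : ℕ} (hc : 0 < anchor F i c) :
    anchor F i c ∈ F i c :=
  anchor_mem ((h.filling.1 i c).2 (h.lt_of_anchor_pos hc))

theorem canBeFreeIn_iff (h : IsSetFilling d F) {k c : ℕ} {j : Fin n} :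
    CanBeFreeIn d F k j c ↔ k < anchor F j c ∧ anchor F j (c + 1) ≤ k := by
  constructor
  · rintro ⟨-, h2, h3⟩
    refine ⟨h2, ?_⟩
    by_cases hc : c + 1 < d j
    · exact h3 hc
    · rw [h.anchor_eq_zero (not_lt.1 hc)]
      exact Nat.zero_le _
  · rintro ⟨h1, h2⟩
    exact ⟨h.lt_of_anchor_pos (by omega), h1, fun _ => h2⟩

theorem canBeFreeIn_of_mem (h : IsSetFilling d F) {k c : ℕ} {i : Fin n} (hk : k ∈ F i c)
    (hne : k ≠ anchor F i c) : k < anchor F i c ∧ anchor F i (c + 1) ≤ k :=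
  ⟨lt_of_le_of_ne (le_anchor hk) hne, h.anchor_succ_le hk⟩

/-- By (S.4) the box of a free entry is the one of least anchor that has room for it, and the
anchors alone decide where there is room. -/
theorem eq_of_anchor_eq (h : IsSetFilling d F) (h' : IsSetFilling d' F')
    (ha : ∀ i c, anchor F i c = anchor F' i c) (hf : ∀ c, freeColumn F c = freeColumn F' c) :
    F = F' := by
  have key : ∀ {d d' : Fin n → ℕ} {F F' : Filling n}, IsSetFilling d F → IsSetFilling d' F' →
      (∀ i c, anchor F i c = anchor F' i c) → (∀ c, freeColumn F c = freeColumn F' c) →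
      ∀ i c, F i c ⊆ F' i c := by
    intro d d' F F' h h' ha hf i c k hk
    by_cases hne : k = anchor F i c
    · have hpos := h.filling.2 i c k hk
      rw [hne, ha] at hpos ⊢
      exact h'.anchor_mem_of_pos hpos
    · have hk' := mem_freeColumn.2 ⟨i, hne, hk⟩
      rw [hf, mem_freeColumn] at hk'
      obtain ⟨j, hj, hkj⟩ := hk'
      have h1 := h.canBeFreeIn_of_mem hk hne
      have h2 := h'.canBeFreeIn_of_mem hkj hj
      have h3 := h.free i c k hk hne j (h.canBeFreeIn_iff.2 (by rw [ha, ha]; exact h2))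
      have h4 := h'.free j c k hkj hj i (h'.canBeFreeIn_iff.2 (by rw [← ha, ← ha]; exact h1))
      have h5 : anchor F i c = anchor F j c := by
        rw [ha j] at h3 ⊢
        rw [ha i] at h3 ⊢
        exact le_antisymm h3 h4
      have h6 : i = j := by
        refine h.row_eq_of_mem (c := c) (h.anchor_mem_of_pos (i := i) (by omega)) ?_
        rw [h5]
        exact h.anchor_mem_of_pos (by omega)
      rw [h6]
      exact hkj
  funext i c
  exact Finset.Subset.antisymm (key h h' ha hf i c)
    (key h' h (fun i c => (ha i c).symm) (fun c => (hf c).symm) i c)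

theorem not_mem_freeColumn (h : IsSetFilling d F) {i : Fin n} {c : ℕ} (hpos : 0 < anchor F i c) :
    anchor F i c ∉ freeColumn F c := by
  rw [mem_freeColumn]
  rintro ⟨j, hne, hj⟩
  exact hne (h.row_eq_of_mem hj (h.anchor_mem_of_pos hpos) ▸ rfl)

theorem exists_mem_iff (h : IsSetFilling d F) {x c : ℕ} (hx : 0 < x) :
    (∃ i, x ∈ F i c) ↔ x ∈ freeColumn F c ∨ ∃ i, anchor F i c = x := by
  rw [mem_freeColumn]
  constructor
  · rintro ⟨i, hi⟩
    by_cases hne : x = anchor F i c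
    · exact Or.inr ⟨i, hne.symm⟩
    · exact Or.inl ⟨i, hne, hi⟩
  · rintro (⟨i, -, hi⟩ | ⟨i, rfl⟩)
    · exact ⟨i, hi⟩
    · exact ⟨i, h.anchor_mem_of_pos hx⟩

theorem excess_eq (h : IsSetFilling d F) {M : ℕ} (hM : ∀ i, d i ≤ M) :
    excess d F = ∑ c ∈ Finset.range M, (freeColumn F c).card := by
  have h1 : excess d F =
      ∑ i, ∑ c ∈ Finset.range M, ((F i c).erase (anchor F i c)).card := by
    refine Finset.sum_congr rfl fun i _ =>
      Finset.sum_subset (Finset.range_subset_range.2 (hM i)) fun c _ hc => ?_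
    rw [h.eq_empty (by simpa using hc)]
    rfl
  rw [h1, Finset.sum_comm]
  refine Finset.sum_congr rfl fun c _ => ?_
  rw [freeColumn, Finset.card_biUnion]
  intro i _ j _ hij
  exact (h.columns c i j hij).mono (Finset.erase_subset _ _) (Finset.erase_subset _ _)

theorem weight_eq (h : IsSetFilling d F) {M : ℕ} (hM : ∀ i, d i ≤ M) (v : Fin n)
    [DecidablePred fun c => ∃ i, (v : ℕ) + 1 ∈ F i c] :
    weight d F v = ((Finset.range M).filter fun c => ∃ i, (v : ℕ) + 1 ∈ F i c).card := by
  classical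
  have h2 : ((Finset.range M).filter fun c => ∃ i, (v : ℕ) + 1 ∈ F i c) =
      Finset.univ.biUnion fun i => (Finset.range (d i)).filter fun c => (v : ℕ) + 1 ∈ F i c := by
    ext c
    simp only [Finset.mem_filter, Finset.mem_range, Finset.mem_biUnion, Finset.mem_univ, true_and]
    constructor
    · rintro ⟨-, i, hi⟩
      exact ⟨i, (h.filling.1 i c).1 ⟨_, hi⟩, hi⟩
    · rintro ⟨i, hc, hi⟩
      exact ⟨hc.trans_le (hM i), i, hi⟩
  rw [h2, Finset.card_biUnion, weight]
  intro i _ j _ hij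
  rw [Function.onFun, Finset.disjoint_left]
  intro c hc hc'
  exact hij (h.row_eq_of_mem (Finset.mem_filter.1 hc).2 (Finset.mem_filter.1 hc').2)

end IsSetFilling

/-- The fillings `F` and `F'` have the same anchors and the same free entries in each column. -/
def SameEntries (F F' : Filling n) : Prop :=
  SameColumns (anchors F) (anchors F') ∧ ∀ c, freeColumn F c = freeColumn F' c

theorem SameColumns.anchor {F F' : Filling n} (h : SameColumns (anchors F) (anchors F')) {c x : ℕ}
    (hx : 0 < x) : (∃ i, anchor F i c = x) ↔ ∃ i, anchor F' i c = x :=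
  h (c + 1) x hx

theorem SameEntries.excess_eq {d d' : Fin n → ℕ} {F F' : Filling n} (h : SameEntries F F')
    (hF : IsSetFilling d F) (hF' : IsSetFilling d' F') : excess d F = excess d' F' := by
  have hM : ∀ i, d i ≤ ∑ i, (d i + d' i) ∧ d' i ≤ ∑ i, (d i + d' i) := fun i => by
    have := Finset.single_le_sum (f := fun i => d i + d' i) (fun _ _ => Nat.zero_le _)
      (Finset.mem_univ i)
    omega
  rw [hF.excess_eq fun i => (hM i).1, hF'.excess_eq fun i => (hM i).2]
  exact Finset.sum_congr rfl fun c _ => by rw [h.2]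

theorem SameEntries.weight_eq {d d' : Fin n → ℕ} {F F' : Filling n} (h : SameEntries F F')
    (hF : IsSetFilling d F) (hF' : IsSetFilling d' F') : weight d F = weight d' F' := by
  classical
  have hM : ∀ i, d i ≤ ∑ i, (d i + d' i) ∧ d' i ≤ ∑ i, (d i + d' i) := fun i => by
    have := Finset.single_le_sum (f := fun i => d i + d' i) (fun _ _ => Nat.zero_le _)
      (Finset.mem_univ i)
    omega
  funext v
  rw [hF.weight_eq fun i => (hM i).1, hF'.weight_eq fun i => (hM i).2]
  congr 1
  refine Finset.filter_congr fun c _ => ?_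
  rw [hF.exists_mem_iff v.1.succ_pos, hF'.exists_mem_iff v.1.succ_pos, h.2, h.1.anchor v.1.succ_pos]

/-! ### Free entries are determined by the columns -/

namespace AnchorFilling

variable {d d' : Fin n → ℕ} {G G' : Fin n → ℕ → ℕ} {r r' : Fin n → Fin n → Prop}

theorem card_lt_eq (h : AnchorFilling r d G) (h' : AnchorFilling r' d' G')
    (hcol : SameColumns G G') (c k : ℕ) :
    (Finset.univ.filter fun i => k < G i c).card =
      (Finset.univ.filter fun i => k < G' i c).card := by
  have hinj : ∀ {d : Fin n → ℕ} {G : Fin n → ℕ → ℕ} {r : Fin n → Fin n → Prop},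
      AnchorFilling r d G →
      Set.InjOn (fun i => G i c) (Finset.univ.filter fun i => k < G i c : Finset (Fin n)) := by
    intro d G r h i hi j hj he
    have hi' := (Finset.mem_filter.1 (Finset.mem_coe.1 hi)).2
    have hj' := (Finset.mem_filter.1 (Finset.mem_coe.1 hj)).2
    by_contra hne
    exact h.column i j c hne ((h.ne_zero_iff i c).1 (by omega)) ((h.ne_zero_iff j c).1 (by omega)) he
  rw [← Finset.card_image_of_injOn (hinj h), ← Finset.card_image_of_injOn (hinj h')]
  congr 1
  ext x
  simp only [Finset.mem_image, Finset.mem_filter, Finset.mem_univ, true_and]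
  constructor
  · rintro ⟨i, hi, rfl⟩
    obtain ⟨j, hj⟩ := (hcol c (G i c) (by omega)).1 ⟨i, rfl⟩
    exact ⟨j, by omega, hj⟩
  · rintro ⟨i, hi, rfl⟩
    obtain ⟨j, hj⟩ := (hcol c (G' i c) (by omega)).2 ⟨i, rfl⟩
    exact ⟨j, by omega, hj⟩

/-- Since rows decrease, some row passes from above `k` to at most `k` exactly when the number of
entries above `k` drops from column `c` to column `c + 1`. These numbers depend only on the column
sets. -/
theorem exists_room (h : AnchorFilling r d G) (h' : AnchorFilling r' d' G')
    (hcol : SameColumns G G') {c k : ℕ} (hex : ∃ i, k < G i c ∧ G i (c + 1) ≤ k) :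
    ∃ i, k < G' i c ∧ G' i (c + 1) ≤ k := by
  by_contra hcon
  push Not at hcon
  obtain ⟨i, hi, hi'⟩ := hex
  have h1 : (Finset.univ.filter fun i => k < G i (c + 1)).card <
      (Finset.univ.filter fun i => k < G i c).card := by
    refine Finset.card_lt_card ((Finset.ssubset_iff_of_subset fun j => ?_).2 ⟨i, ?_, ?_⟩)
    · simp only [Finset.mem_filter, Finset.mem_univ, true_and]
      exact fun hj => hj.trans_le (h.row j c)
    · simpa using hi
    · simpa using hi'
  have h2 : (Finset.univ.filter fun i => k < G' i c).card ≤
      (Finset.univ.filter fun i => k < G' i (c + 1)).card :=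
    Finset.card_le_card fun j => by
      simp only [Finset.mem_filter, Finset.mem_univ, true_and]
      exact hcon j
  rw [h.card_lt_eq h' hcol, h.card_lt_eq h' hcol] at h1
  omega

theorem exists_setFilling {F : Filling n} (hF : IsSetFilling d F)
    (h : AnchorFilling r d (anchors F)) (h' : AnchorFilling r' d' G')
    (hcol : SameColumns (anchors F) G') :
    ∃ F', IsSetFilling d' F' ∧ anchors F' = G' ∧ ∀ c, freeColumn F c = freeColumn F' c := by
  classical
  -- Row `i` is where (S.4) sends `k`. The basement of `G'` is column `0`, so box column `c` has its
  -- anchors in column `c + 1`.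
  let good : ℕ → ℕ → Fin n → Prop := fun k c i => (k < G' i (c + 1) ∧ G' i (c + 2) ≤ k) ∧
    ∀ j, k < G' j (c + 1) → G' j (c + 2) ≤ k → G' i (c + 1) ≤ G' j (c + 1)
  let F' : Filling n := fun i c => if c < d' i then
    insert (G' i (c + 1)) ((freeColumn F c).filter fun k => good k c i) else ∅
  have hmem : ∀ i c k, k ∈ F' i c ↔ c < d' i ∧ (k = G' i (c + 1) ∨ k ∈ freeColumn F c ∧ good k c i) := by
    intro i c k
    simp only [F']
    split_ifs with hc <;> simp [hc]
  have hlt : ∀ i c, 0 < G' i (c + 1) → c < d' i := fun i c hc => by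
    have := (h'.ne_zero_iff i (c + 1)).1 hc.ne'
    omega
  have hanchor : ∀ i c, anchor F' i c = G' i (c + 1) := by
    intro i c
    by_cases hc : c < d' i
    · refine le_antisymm (Finset.sup_le fun k hk => ?_) (le_anchor ((hmem i c _).2 ⟨hc, Or.inl rfl⟩))
      rcases ((hmem i c k).1 hk).2 with rfl | ⟨-, hg⟩
      · exact le_rfl
      · exact hg.1.1.le
    · rw [h'.zero i (c + 1) (by omega), anchor, show F' i c = ∅ from if_neg hc]
      rfl
  have hfree : ∀ i c k, k ∈ F' i c → k ≠ anchor F' i c → k ∈ freeColumn F c ∧ good k c i := by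
    intro i c k hk hne
    rw [hanchor] at hne
    exact ((hmem i c k).1 hk).2.resolve_left hne
  have hpos : ∀ c k, k ∈ freeColumn F c → 0 < k := by
    intro c k hk
    obtain ⟨j, -, hj⟩ := mem_freeColumn.1 hk
    exact hF.filling.2 j c k hj
  have hnot : ∀ i c, 0 < G' i (c + 1) → G' i (c + 1) ∉ freeColumn F c := by
    intro i c hp
    obtain ⟨j, hj⟩ := (hcol (c + 1) _ hp).2 ⟨i, rfl⟩
    rw [← hj] at hp ⊢
    exact hF.not_mem_freeColumn hp
  refine ⟨F', ⟨⟨fun i c => ⟨?_, fun hc => ⟨_, (hmem i c _).2 ⟨hc, Or.inl rfl⟩⟩⟩, ?_⟩, ?_, ?_, ?_⟩,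
    ?_, ?_⟩
  · rintro ⟨k, hk⟩
    exact ((hmem i c k).1 hk).1
  · intro i c k hk
    obtain ⟨hc, rfl | ⟨hf, -⟩⟩ := (hmem i c k).1 hk
    · exact h'.pos i (c + 1) hc
    · exact hpos c k hf
  · intro c i j hij
    rw [Finset.disjoint_left]
    intro k hi hj
    obtain ⟨hci, hi⟩ := (hmem i c k).1 hi
    obtain ⟨hcj, hj⟩ := (hmem j c k).1 hj
    have hcne := h'.column i j (c + 1) hij hci hcj
    rcases hi with rfl | ⟨hfi, hgi⟩
    · rcases hj with hj | ⟨hfj, -⟩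
      · exact hcne hj
      · exact hnot i c (h'.pos i (c + 1) hci) hfj
    · rcases hj with rfl | ⟨-, hgj⟩
      · exact hnot j c (h'.pos j (c + 1) hcj) hfi
      · exact hcne (le_antisymm (hgi.2 j hgj.1.1 hgj.1.2) (hgj.2 i hgi.1.1 hgi.1.2))
  · intro i c x hx y hy
    have h1 : y ≤ G' i (c + 2) := by
      rw [← hanchor]
      exact le_anchor hy
    obtain ⟨-, rfl | ⟨-, hg⟩⟩ := (hmem i c x).1 hx
    · exact h1.trans (h'.row i (c + 1))
    · exact h1.trans hg.1.2
  · intro i c k hk hne j hj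
    obtain ⟨hcj, hkj, hkj'⟩ := hj
    obtain ⟨-, hg⟩ := hfree i c k hk hne
    rw [hanchor] at hkj ⊢
    rw [hanchor]
    refine hg.2 j hkj ?_
    by_cases hc : c + 1 < d' j
    · have := hkj' hc
      rwa [hanchor] at this
    · rw [h'.zero j (c + 2) (by omega)]
      exact Nat.zero_le _
  · funext i c
    cases c with
    | zero => exact (h'.basement i).symm
    | succ c => exact hanchor i c
  · intro c
    ext k
    rw [mem_freeColumn (F := F')]
    constructor
    · intro hk
      obtain ⟨i, hne, hi⟩ := mem_freeColumn.1 hk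
      obtain ⟨j, hj, hj'⟩ := h.exists_room h' hcol (c := c + 1) (k := k)
        ⟨i, hF.canBeFreeIn_of_mem hi hne⟩
      obtain ⟨m, hm, hmin⟩ := Finset.exists_min_image
        (Finset.univ.filter fun j => k < G' j (c + 1) ∧ G' j (c + 2) ≤ k) (fun j => G' j (c + 1))
        ⟨j, Finset.mem_filter.2 ⟨Finset.mem_univ _, hj, hj'⟩⟩
      have hm' := (Finset.mem_filter.1 hm).2
      refine ⟨m, by rw [hanchor]; exact hm'.1.ne, (hmem m c k).2 ⟨hlt m c (by omega), Or.inr ⟨hk, hm',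
        fun j hj hj' => hmin j (Finset.mem_filter.2 ⟨Finset.mem_univ _, hj, hj'⟩)⟩⟩⟩
    · rintro ⟨i, hne, hi⟩
      exact (hfree i c k hi hne).1

end AnchorFilling

/-! ### Atom and key fillings in terms of anchors -/

theorem IsSetFilling.anchors_pos {d : Fin n → ℕ} {F : Filling n} (h : IsSetFilling d F) (i : Fin n)
    (c : ℕ) (hc : c ≤ d i) : 0 < anchors F i c := by
  cases c with
  | zero => exact Nat.succ_pos _
  | succ c => exact h.anchor_pos hc

theorem IsSetFilling.anchors_zero {d : Fin n → ℕ} {F : Filling n} (h : IsSetFilling d F) (i : Fin n)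
    (c : ℕ) (hc : d i < c) : anchors F i c = 0 := by
  cases c with
  | zero => omega
  | succ c => exact h.anchor_eq_zero (by omega)

theorem IsSetFilling.anchor_row {d : Fin n → ℕ} {F : Filling n} (h : IsSetFilling d F) (i : Fin n)
    (c : ℕ) : anchor F i (c + 1) ≤ anchor F i c := by
  by_cases hc : c < d i
  · exact h.anchor_succ_le (anchor_mem ((h.filling.1 i c).2 hc))
  · rw [h.anchor_eq_zero (by omega)]
    exact Nat.zero_le _

theorem IsSetFilling.anchors_column {d : Fin n → ℕ} {F : Filling n} (h : IsSetFilling d F)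
    (i j : Fin n) (c : ℕ) (hij : i ≠ j) (hi : c ≤ d i) (hj : c ≤ d j) :
    anchors F i c ≠ anchors F j c := by
  cases c with
  | zero =>
    simp only [anchors, ne_eq, Nat.add_right_cancel_iff]
    exact fun he => hij (Fin.ext he)
  | succ c =>
    intro he
    have h1 := anchor_mem ((h.filling.1 i c).2 hi)
    have h2 := anchor_mem ((h.filling.1 j c).2 hj)
    simp only [anchors] at he
    rw [he] at h1
    exact hij (h.row_eq_of_mem h1 h2)

theorem isInversionTriple_iff {α β γ : ℕ} (h : α ≤ β) :
    IsInversionTriple α β γ ↔ γ < α ∨ β < γ := by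
  unfold IsInversionTriple
  omega

/-- Given (S.5), triples meeting the basement are inversion triples automatically; the converse is
`eq_of_column_one`. -/
theorem mem_atomFillings_iff {b : Fin n → ℕ} {F : Filling n} :
    F ∈ atomFillings b ↔ IsSetFilling b F ∧ AnchorFilling (· < ·) b (anchors F) := by
  constructor
  · rintro ⟨hF, h5⟩
    have h : IsSetFilling b F := ⟨hF.filling, hF.columns, hF.rows, hF.free⟩
    refine ⟨h, fun i => rfl, h.anchors_pos, h.anchors_zero, fun i c => ?_, h.anchors_column, ?_, ?_⟩
    · cases c with
      | zero =>
        simp only [anchors]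
        by_cases hb : 0 < b i
        · exact (h5 i hb).le
        · rw [h.anchor_eq_zero (by omega)]
          exact Nat.zero_le _
      | succ c => exact h.anchor_row i c
    · intro i j hij hd c hc
      have hij' : (i : ℕ) < j := hij
      cases c with
      | zero =>
        simp only [anchors]
        rw [h5 j hc]
        omega
      | succ c =>
        exact (isInversionTriple_iff (h.anchor_row i c)).1
          ((hF.triples i j hij c).1 hd (by omega) hc)
    · intro i j hij hd c hc
      have hij' : (i : ℕ) < j := hij
      cases c with
      | zero =>
        simp only [anchors]
        rw [h5 j (by omega)]
        omega
      | succ c =>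
        exact (isInversionTriple_iff (h.anchor_row j c)).1
          ((hF.triples i j hij c).2 hd (by omega) (by omega))
  · rintro ⟨h, hG⟩
    refine ⟨⟨h.filling, h.columns, h.rows, fun i j hij c => ⟨fun hd h1 h2 => ?_,
      fun hd h1 h2 => ?_⟩, h.free⟩, fun i hi => hG.eq_of_column_one i hi⟩
    · exact (isInversionTriple_iff (h.anchor_row i c)).2 (hG.long i j hij hd (c + 1) h2)
    · exact (isInversionTriple_iff (h.anchor_row j c)).2 (hG.short i j hij hd (c + 1) h2)

theorem anchor_withBasement (F : Filling n) (i : Fin n) (c : ℕ) :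
    anchor (withBasement (fun i => n - (i : ℕ)) F) i c = anchors (fun v => F v.rev) i.rev c := by
  cases c with
  | zero =>
    simp only [anchor, withBasement, anchors, Finset.sup_singleton, id, Fin.val_rev]
    omega
  | succ c => simp [anchor, withBasement, anchors]

/-- Reversing the rows replaces the shape `reverse a` by `a` and the basement entry `n - i` by `i +
1`, at the price of reversing the vertical order. -/
theorem mem_lascouxFillings_iff {a : Fin n → ℕ} {F : Filling n} :
    F ∈ lascouxFillings a ↔ IsSetFilling a (fun v => F v.rev) ∧
      AnchorFilling (· > ·) a (anchors fun v => F v.rev) := by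
  set W := withBasement (fun i => n - (i : ℕ)) F with hW
  set F' : Filling n := fun v => F v.rev with hF'
  have hWF : ∀ v c, W v.rev (c + 1) = F' v c := fun _ _ => rfl
  have hWA : ∀ v c, anchor W v.rev c = anchors F' v c := fun v c => by
    rw [hW, anchor_withBasement, Fin.rev_rev]
  have hWA' : ∀ v c, anchor W v c = anchors F' v.rev c := fun v c => by
    rw [hW, anchor_withBasement]
  have hcan : ∀ k v c, CanBeFreeIn (fun i => reverse a i + 1) W k v.rev (c + 1) ↔
      CanBeFreeIn a F' k v c := by
    intro k v c
    unfold CanBeFreeIn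
    rw [hWA, hWA]
    simp [reverse, anchors]
  constructor
  · intro hF
    have h : IsSetFilling a F' := by
      refine ⟨⟨fun i c => ?_, fun i c => hF.filling.2 i.rev (c + 1)⟩, fun c i j hij => ?_,
        fun i c => hF.rows i.rev (c + 1), fun i c k hk hne j hj => ?_⟩
      · rw [← hWF, hF.filling.1]
        simp [reverse]
      · exact hF.columns (c + 1) i.rev j.rev (by simpa using hij)
      · have := hF.free i.rev (c + 1) k hk (by rw [hWA]; exact hne) j.rev ((hcan k j c).2 hj)
        rwa [hWA, hWA] at this
    have hrow : ∀ i c, anchors F' i (c + 1) ≤ anchors F' i c := by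
      intro i c
      cases c with
      | zero =>
        by_cases hi : 0 < a i
        · have h1 := hF.rows i.rev 0 (n - (i.rev : ℕ)) (by simp [withBasement]) (anchor F' i 0)
            (anchor_mem ((h.filling.1 i 0).2 hi))
          have h2 : n - (i.rev : ℕ) = i + 1 := by rw [Fin.val_rev]; omega
          rwa [h2] at h1
        · exact (h.anchor_eq_zero (show a i ≤ 0 by omega)).le.trans (Nat.zero_le _)
      | succ c => exact h.anchor_row i c
    refine ⟨h, fun i => rfl, h.anchors_pos, h.anchors_zero, hrow, h.anchors_column, ?_, ?_⟩
    · intro i j hij hd c hc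
      have := (hF.triples i.rev j.rev (Fin.rev_lt_rev.2 hij) c).1
        (by simpa [reverse] using hd) (by simp [reverse]; omega) (by simpa [reverse] using hc)
      rw [hWA, hWA, hWA] at this
      exact (isInversionTriple_iff (hrow i c)).1 this
    · intro i j hij hd c hc
      have := (hF.triples i.rev j.rev (Fin.rev_lt_rev.2 hij) c).2
        (by simpa [reverse] using hd) (by simp [reverse]; omega) (by simp [reverse]; omega)
      rw [hWA, hWA, hWA] at this
      exact (isInversionTriple_iff (hrow j c)).1 this
  · rintro ⟨h, hG⟩
    refine ⟨⟨fun i c => ?_, fun i c k hk => ?_⟩, fun c i j hij => ?_, fun i c x hx y hy => ?_,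
      fun i j hij c => ⟨fun hd h1 h2 => ?_, fun hd h1 h2 => ?_⟩, fun i c k hk hne j hj => ?_⟩
    · cases c with
      | zero => simp [withBasement]
      | succ c =>
        have := h.filling.1 i.rev c
        simpa [reverse, withBasement, hF'] using this
    · cases c with
      | zero =>
        simp only [withBasement, Finset.mem_singleton] at hk
        omega
      | succ c => exact h.filling.2 i.rev c k (by simpa [hF', withBasement] using hk)
    · cases c with
      | zero =>
        simp only [withBasement, Finset.disjoint_singleton]
        intro he
        exact hij (Fin.ext (by omega))
      | succ c => simpa [hF', withBasement] using h.columns c i.rev j.rev (by simpa using hij)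
    · cases c with
      | zero =>
        have h1 : y ≤ anchors F' i.rev 1 := le_anchor (by simpa [hF', withBasement] using hy)
        have h2 := hG.row i.rev 0
        have h3 := hG.basement i.rev
        simp only [withBasement, Finset.mem_singleton] at hx
        rw [Fin.val_rev] at h3
        rw [zero_add] at h2
        omega
      | succ c =>
        exact h.rows i.rev c x (by simpa [hF', withBasement] using hx) y
          (by simpa [hF', withBasement] using hy)
    · rw [← hW, hWA', hWA', hWA', isInversionTriple_iff (hG.row _ c)]
      simp only [reverse] at hd h1 h2
      exact hG.long i.rev j.rev (Fin.rev_lt_rev.2 hij) (by omega) c (by omega)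
    · rw [← hW, hWA', hWA', hWA', isInversionTriple_iff (hG.row _ c)]
      simp only [reverse] at hd h1 h2
      exact hG.short i.rev j.rev (Fin.rev_lt_rev.2 hij) (by omega) c (by omega)
    · cases c with
      | zero =>
        rw [← hW, hWA'] at hne
        simp only [withBasement, Finset.mem_singleton] at hk
        simp only [anchors, Fin.val_rev] at hne
        omega
      | succ c =>
        rw [← hW] at hne hj ⊢
        have hj' := (hcan k j.rev c).1 (by rwa [Fin.rev_rev])
        have := h.free i.rev c k (by simpa [hF', withBasement] using hk)
          (by rwa [hWA'] at hne) j.rev hj'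
        rw [hWA', hWA']
        exact this

/-! ### The decomposition of Lascoux polynomials into atoms -/

theorem excess_rev (a : Fin n → ℕ) (F : Filling n) :
    excess (reverse a) F = excess a fun v => F v.rev := by
  unfold excess
  rw [← Equiv.sum_comp Fin.revPerm]
  simp [reverse, anchor]

theorem weight_rev (a : Fin n → ℕ) (F : Filling n) :
    weight (reverse a) F = weight a fun v => F v.rev := by
  funext v
  unfold weight
  rw [← Equiv.sum_comp Fin.revPerm]
  simp [reverse]

theorem sum_eq_of_rel {α β M : Type*} [AddCommMonoid M] {s : Finset α} {t : Finset β}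
    (R : α → β → Prop) {f : α → M} {g : β → M} (hs : ∀ x ∈ s, ∃ y ∈ t, R x y)
    (ht : ∀ y ∈ t, ∃ x ∈ s, R x y)
    (hl : ∀ x ∈ s, ∀ x' ∈ s, ∀ y ∈ t, R x y → R x' y → x = x')
    (hr : ∀ x ∈ s, ∀ y ∈ t, ∀ y' ∈ t, R x y → R x y' → y = y')
    (hfg : ∀ x ∈ s, ∀ y ∈ t, R x y → f x = g y) : ∑ x ∈ s, f x = ∑ y ∈ t, g y := by
  choose φ hφ hR using hs
  refine Finset.sum_bij φ hφ (fun x hx x' hx' he => ?_) (fun y hy => ?_) fun x hx =>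
    hfg x hx _ (hφ x hx) (hR x hx)
  · exact hl x hx x' hx' _ (hφ x' hx') (he ▸ hR x hx) (hR x' hx')
  · obtain ⟨x, hx, hxy⟩ := ht y hy
    exact ⟨x, hx, hr x hx _ (hφ x hx) y hy (hR x hx) hxy⟩

theorem lascouxPoly_eq_sum_lswap (a : Fin n → ℕ) :
    lascouxPoly a = ∑ b ∈ (lswap_finite a).toFinset, lascouxAtom b := by
  unfold lascouxPoly lascouxAtom
  rw [Finset.sum_sigma']
  refine sum_eq_of_rel (fun F y => SameEntries (fun v => F v.rev) y.2) ?_ ?_ ?_ ?_ ?_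
  · intro F hF
    obtain ⟨h, hG⟩ := mem_lascouxFillings_iff.1 ((Set.Finite.mem_toFinset _).1 hF)
    obtain ⟨b, H, hdom, hH, hcol⟩ := hG.exists_atom
    obtain ⟨F', hF', rfl, hfree⟩ := hG.exists_setFilling h hH hcol
    refine ⟨⟨b, F'⟩, ?_, hcol, hfree⟩
    rw [Finset.mem_sigma, Set.Finite.mem_toFinset, Set.Finite.mem_toFinset,
      mem_lswap_iff_dominates, mem_atomFillings_iff]
    exact ⟨hdom, hF', hH⟩
  · rintro ⟨b, F'⟩ hy
    rw [Finset.mem_sigma, Set.Finite.mem_toFinset, Set.Finite.mem_toFinset,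
      mem_lswap_iff_dominates, mem_atomFillings_iff] at hy
    obtain ⟨hdom, hF', hH⟩ := hy
    obtain ⟨G, hG, hcol⟩ := hH.exists_key hdom
    obtain ⟨F, hF, rfl, hfree⟩ := hH.exists_setFilling hF' hG hcol.symm
    refine ⟨fun v => F v.rev, ?_, ?_, ?_⟩
    · rw [Set.Finite.mem_toFinset, mem_lascouxFillings_iff]
      simpa only [Fin.rev_rev] using ⟨hF, hG⟩
    · simpa only [Fin.rev_rev] using hcol
    · simpa only [Fin.rev_rev] using fun c => (hfree c).symm
  · rintro F hF F' hF' ⟨b, K⟩ - hR hR'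
    obtain ⟨h, hG⟩ := mem_lascouxFillings_iff.1 ((Set.Finite.mem_toFinset _).1 hF)
    obtain ⟨h', hG'⟩ := mem_lascouxFillings_iff.1 ((Set.Finite.mem_toFinset _).1 hF')
    have he := hG.key_unique hG' (hR.1.trans hR'.1.symm)
    have := h.eq_of_anchor_eq h' (fun i c => congrFun (congrFun he i) (c + 1))
      fun c => (hR.2 c).trans (hR'.2 c).symm
    funext v
    simpa using congrFun this v.rev
  · rintro F - ⟨b, K⟩ hy ⟨b', K'⟩ hy' hR hR'
    rw [Finset.mem_sigma, Set.Finite.mem_toFinset, Set.Finite.mem_toFinset,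
      mem_atomFillings_iff] at hy hy'
    obtain ⟨rfl, he⟩ := hy.2.2.atom_unique hy'.2.2 (hR.1.symm.trans hR'.1)
    have := hy.2.1.eq_of_anchor_eq hy'.2.1 (fun i c => congrFun (congrFun he i) (c + 1))
      fun c => (hR.2 c).symm.trans (hR'.2 c)
    simp only at this
    rw [this]
  · rintro F hF ⟨b, K⟩ hy hR
    obtain ⟨h, -⟩ := mem_lascouxFillings_iff.1 ((Set.Finite.mem_toFinset _).1 hF)
    rw [Finset.mem_sigma, Set.Finite.mem_toFinset, Set.Finite.mem_toFinset,
      mem_atomFillings_iff] at hy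
    rw [excess_rev, weight_rev, hR.excess_eq h hy.2.1, hR.weight_eq h hy.2.1]

end SetValued

/-! ### The operators `τ_i` -/

section Operators

variable {n : ℕ}

open MvPolynomial in
theorem X_sub_X_ne_zero {i j : Fin n} (h : i ≠ j) : (X i - X j : Poly n) ≠ 0 :=
  fun he => h (X_injective (sub_eq_zero.1 he))

theorem swapVars_add (i j : Fin n) (f g : Poly n) :
    swapVars i j (f + g) = swapVars i j f + swapVars i j g := map_add _ _ _

theorem swapVars_sub (i j : Fin n) (f g : Poly n) :
    swapVars i j (f - g) = swapVars i j f - swapVars i j g := map_sub _ _ _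

theorem swapVars_mul (i j : Fin n) (f g : Poly n) :
    swapVars i j (f * g) = swapVars i j f * swapVars i j g := map_mul _ _ _

theorem swapVars_one (i j : Fin n) : swapVars i j (1 : Poly n) = 1 := map_one _

theorem swapVars_X (i j k : Fin n) :
    swapVars i j (MvPolynomial.X k) = MvPolynomial.X (Equiv.swap i j k) :=
  MvPolynomial.rename_X _ _

theorem swapVars_beta (i j : Fin n) : swapVars i j (beta n) = beta n :=
  MvPolynomial.rename_C _ _

theorem swapVars_swapVars (i j k l : Fin n) (f : Poly n) :
    swapVars i j (swapVars k l f) =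
      MvPolynomial.rename (⇑(Equiv.swap i j * Equiv.swap k l)) f := by
  rw [swapVars, swapVars, MvPolynomial.rename_rename]
  rfl

theorem swapVars_self_apply (i j : Fin n) (f : Poly n) : swapVars i j (swapVars i j f) = f := by
  rw [swapVars_swapVars, Equiv.swap_mul_self]
  exact MvPolynomial.rename_id_apply f

theorem swapVars_comm {i j k l : Fin n} (h : Disjoint ({i, j} : Set (Fin n)) {k, l})
    (f : Poly n) : swapVars i j (swapVars k l f) = swapVars k l (swapVars i j f) := by
  rw [swapVars_swapVars, swapVars_swapVars]
  congr 2
  ext x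
  simp only [Set.disjoint_insert_left, Set.disjoint_singleton_left, Set.mem_insert_iff,
    Set.mem_singleton_iff, not_or] at h
  simp only [Equiv.Perm.mul_apply, Equiv.swap_apply_def]
  grind

theorem swapVars_braid {i j k : Fin n} (hij : i ≠ j) (hjk : j ≠ k) (hik : i ≠ k) (f : Poly n) :
    swapVars i j (swapVars j k (swapVars i j f)) =
      swapVars j k (swapVars i j (swapVars j k f)) := by
  simp only [swapVars, MvPolynomial.rename_rename]
  congr 2
  funext x
  simp only [Function.comp_apply, Equiv.swap_apply_def]
  grind

/-- The operator `f ↦ ∂ (x_i (1 + β x_j) f)`, where `∂` is the divided difference for `x_i` and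
`x_j`. -/
noncomputable def isobaric (i j : Fin n) (f : Poly n) : Poly n :=
  divDiff i j (MvPolynomial.X i * (1 + beta n * MvPolynomial.X j) * f)

theorem tau_eq_isobaric (i : Fin n) (f : Poly n) : tau i f = isobaric i (next i) f := rfl

theorem isobaric_spec (i j : Fin n) (f : Poly n) :
    (MvPolynomial.X i - MvPolynomial.X j) * isobaric i j f =
      MvPolynomial.X i * (1 + beta n * MvPolynomial.X j) * f -
        MvPolynomial.X j * (1 + beta n * MvPolynomial.X i) * swapVars i j f := by
  rw [isobaric, ← divDiff_spec]
  simp only [swapVars_mul, swapVars_add, swapVars_one, swapVars_X, swapVars_beta,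
    Equiv.swap_apply_left, Equiv.swap_apply_right]

theorem isobaric_add {i j : Fin n} (h : i ≠ j) (f g : Poly n) :
    isobaric i j (f + g) = isobaric i j f + isobaric i j g := by
  apply mul_left_cancel₀ (X_sub_X_ne_zero h)
  rw [mul_add, isobaric_spec, isobaric_spec, isobaric_spec, swapVars_add]
  ring

theorem isobaric_sub {i j : Fin n} (h : i ≠ j) (f g : Poly n) :
    isobaric i j (f - g) = isobaric i j f - isobaric i j g := by
  rw [eq_sub_iff_add_eq, ← isobaric_add h, sub_add_cancel]

theorem isobaric_zero {i j : Fin n} (h : i ≠ j) : isobaric i j (0 : Poly n) = 0 := by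
  have := isobaric_sub h (0 : Poly n) 0
  rwa [sub_self, sub_self] at this

theorem isobaric_sum {i j : Fin n} (h : i ≠ j) {α : Type*} (s : Finset α) (f : α → Poly n) :
    isobaric i j (∑ x ∈ s, f x) = ∑ x ∈ s, isobaric i j (f x) :=
  map_sum (AddMonoidHom.mk' (isobaric i j) (isobaric_add h)) f s

/-- The `β` terms cancel: `x_i (1 + β x_j) - x_j (1 + β x_i) = x_i - x_j`. -/
theorem isobaric_of_symmetric {i j : Fin n} (h : i ≠ j) {f : Poly n} (hf : swapVars i j f = f) :
    isobaric i j f = f := by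
  apply mul_left_cancel₀ (X_sub_X_ne_zero h)
  rw [isobaric_spec, hf]
  ring

theorem swapVars_isobaric {i j : Fin n} (h : i ≠ j) (f : Poly n) :
    swapVars i j (isobaric i j f) = isobaric i j f := by
  have h1 := congrArg (swapVars i j) (isobaric_spec i j f)
  simp only [swapVars_mul, swapVars_sub, swapVars_add, swapVars_one, swapVars_X, swapVars_beta,
    Equiv.swap_apply_left, Equiv.swap_apply_right, swapVars_self_apply] at h1
  have h2 := isobaric_spec i j f
  apply mul_left_cancel₀ (X_sub_X_ne_zero h)
  linear_combination -h1 - h2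

theorem isobaric_isobaric {i j : Fin n} (h : i ≠ j) (f : Poly n) :
    isobaric i j (isobaric i j f) = isobaric i j f :=
  isobaric_of_symmetric h (swapVars_isobaric h f)

theorem isobaric_comm {i j k l : Fin n} (hij : i ≠ j) (hkl : k ≠ l)
    (h : Disjoint ({i, j} : Set (Fin n)) {k, l}) (f : Poly n) :
    isobaric i j (isobaric k l f) = isobaric k l (isobaric i j f) := by
  have hs := swapVars_comm h f
  simp only [Set.disjoint_insert_left, Set.disjoint_singleton_left, Set.mem_insert_iff,
    Set.mem_singleton_iff, not_or] at h
  obtain ⟨⟨hik, hil⟩, hjk, hjl⟩ := h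
  have h1 := isobaric_spec i j f
  have h2 := isobaric_spec k l f
  have h3 := isobaric_spec i j (isobaric k l f)
  have h4 := isobaric_spec k l (isobaric i j f)
  have h5 := congrArg (swapVars k l) h1
  have h6 := congrArg (swapVars i j) h2
  simp only [swapVars_mul, swapVars_sub, swapVars_add, swapVars_one, swapVars_X, swapVars_beta,
    Equiv.swap_apply_of_ne_of_ne hik hil, Equiv.swap_apply_of_ne_of_ne hjk hjl,
    Equiv.swap_apply_of_ne_of_ne (Ne.symm hik) (Ne.symm hjk),
    Equiv.swap_apply_of_ne_of_ne (Ne.symm hil) (Ne.symm hjl)] at h5 h6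
  rw [hs] at h6
  apply mul_left_cancel₀ (mul_ne_zero (X_sub_X_ne_zero hij) (X_sub_X_ne_zero hkl))
  linear_combination (MvPolynomial.X k - MvPolynomial.X l) * h3 -
    (MvPolynomial.X i - MvPolynomial.X j) * h4 +
    MvPolynomial.X i * (1 + beta n * MvPolynomial.X j) * h2 -
    MvPolynomial.X j * (1 + beta n * MvPolynomial.X i) * h6 -
    MvPolynomial.X k * (1 + beta n * MvPolynomial.X l) * h1 +
    MvPolynomial.X l * (1 + beta n * MvPolynomial.X k) * h5

theorem isobaric_braid {i j k : Fin n} (hij : i ≠ j) (hjk : j ≠ k) (hik : i ≠ k) (f : Poly n) :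
    isobaric i j (isobaric j k (isobaric i j f)) =
      isobaric j k (isobaric i j (isobaric j k f)) := by
  have hbr := swapVars_braid hij hjk hik f
  have hx := X_sub_X_ne_zero hij
  have hy := X_sub_X_ne_zero hjk
  have hz := X_sub_X_ne_zero hik
  have a1 := isobaric_spec i j f
  have a2 := congrArg (swapVars j k) a1
  have a3 := isobaric_spec j k (isobaric i j f)
  have a4 := congrArg (swapVars i j) a3
  have a5 := congrArg (swapVars i j) a2
  have a6 := isobaric_spec i j (isobaric j k (isobaric i j f))
  have b1 := isobaric_spec j k f
  have b2 := congrArg (swapVars i j) b1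
  have b3 := isobaric_spec i j (isobaric j k f)
  have b4 := congrArg (swapVars j k) b3
  have b5 := congrArg (swapVars j k) b2
  have b6 := isobaric_spec j k (isobaric i j (isobaric j k f))
  simp only [swapVars_mul, swapVars_sub, swapVars_add, swapVars_one, swapVars_X, swapVars_beta,
    Equiv.swap_apply_left, Equiv.swap_apply_right, Equiv.swap_apply_of_ne_of_ne hij hik,
    Equiv.swap_apply_of_ne_of_ne hik.symm hjk.symm, swapVars_isobaric hij,
    swapVars_isobaric hjk] at a1 a2 a3 a4 a5 a6 b1 b2 b3 b4 b5 b6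
  rw [hbr] at a5
  generalize isobaric i j (isobaric j k (isobaric i j f)) = R at *
  generalize isobaric j k (isobaric i j (isobaric j k f)) = R' at *
  generalize swapVars i j (isobaric j k (isobaric i j f)) = sq at *
  generalize isobaric j k (isobaric i j f) = q at *
  generalize swapVars j k (isobaric i j (isobaric j k f)) = tq' at *
  generalize isobaric i j (isobaric j k f) = q' at *
  generalize swapVars i j (swapVars j k (isobaric i j f)) = stp at *
  generalize swapVars j k (isobaric i j f) = tp at *
  generalize isobaric i j f = p at *
  generalize swapVars j k (swapVars i j (isobaric j k f)) = tsp' at *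
  generalize swapVars i j (isobaric j k f) = sp' at *
  generalize isobaric j k f = p' at *
  generalize swapVars j k (swapVars i j (swapVars j k f)) = f5 at *
  generalize swapVars j k (swapVars i j f) = f4 at *
  generalize swapVars i j (swapVars j k f) = f3 at *
  generalize swapVars j k f = f2 at *
  generalize swapVars i j f = f1 at *
  generalize beta n = β at *
  generalize (MvPolynomial.X i : Poly n) = x at *
  generalize (MvPolynomial.X j : Poly n) = y at *
  generalize (MvPolynomial.X k : Poly n) = z at *
  -- The antisymmetrization of the first summand over the six permutations of the three variables.
  -- Both sides of the braid relation equal it divided by the Vandermonde product.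
  let E := x * (1 + β * y) * (x * (1 + β * z)) * (y * (1 + β * z)) * f
    - y * (1 + β * x) * (y * (1 + β * z)) * (x * (1 + β * z)) * f1
    - x * (1 + β * z) * (x * (1 + β * y)) * (z * (1 + β * y)) * f2
    + y * (1 + β * z) * (y * (1 + β * x)) * (z * (1 + β * x)) * f3
    + z * (1 + β * x) * (z * (1 + β * y)) * (x * (1 + β * y)) * f4
    - z * (1 + β * y) * (z * (1 + β * x)) * (y * (1 + β * x)) * f5
  have hR : (x - y) * (x - z) * (y - z) * R = E := by
    apply mul_left_cancel₀ hx
    simp only [E]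
    linear_combination (x - y) * (x - z) * (y - z) * a6
      + x * (1 + β * y) * ((x - y) * (x - z)) * a3
      - y * (1 + β * x) * ((x - y) * (y - z)) * a4
      + x * (1 + β * y) * (y * (1 + β * z) * (x - z)) * a1
      - x * (1 + β * y) * (z * (1 + β * y) * (x - y)) * a2
      - y * (1 + β * x) * (x * (1 + β * z) * (y - z)) * a1
      + y * (1 + β * x) * (z * (1 + β * x) * (x - y)) * a5
  have hR' : (x - y) * (x - z) * (y - z) * R' = E := by
    apply mul_left_cancel₀ hy
    simp only [E]
    linear_combination (x - y) * (x - z) * (y - z) * b6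
      + y * (1 + β * z) * ((y - z) * (x - z)) * b3
      - z * (1 + β * y) * ((x - y) * (y - z)) * b4
      + y * (1 + β * z) * (x * (1 + β * y) * (x - z)) * b1
      - y * (1 + β * z) * (y * (1 + β * x) * (y - z)) * b2
      - z * (1 + β * y) * (x * (1 + β * z) * (x - y)) * b1
      + z * (1 + β * y) * (z * (1 + β * x) * (y - z)) * b5
  exact mul_left_cancel₀ (mul_ne_zero (mul_ne_zero hx hz) hy) (hR.trans hR'.symm)

theorem swapVars_monom (i j : Fin n) (a : Fin n → ℕ) :
    swapVars i j (monom a) = monom (a ∘ Equiv.swap i j) := by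
  unfold swapVars monom
  rw [map_prod, ← Equiv.prod_comp (Equiv.swap i j)]
  refine Finset.prod_congr rfl fun x _ => ?_
  rw [map_pow, MvPolynomial.rename_X, Equiv.swap_apply_self, Function.comp_apply]

theorem tauHat_eq (i : Fin n) (f : Poly n) : tauHat i f = isobaric i (next i) f - f := rfl

theorem tauHat_comm {i j : Fin n} (hi : i ≠ next i) (hj : j ≠ next j)
    (h : Disjoint ({i, next i} : Set (Fin n)) {j, next j}) (f : Poly n) :
    tauHat i (tauHat j f) = tauHat j (tauHat i f) := by
  simp only [tauHat_eq, isobaric_sub hi, isobaric_sub hj, isobaric_comm hi hj h]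
  ring

/-- Expanding with `τ² = τ`, the terms other than the triple products are symmetric in the two
operators. -/
theorem tauHat_braid {i : Fin n} (hi : i ≠ next i) (hj : next i ≠ next (next i)) (f : Poly n) :
    tauHat i (tauHat (next i) (tauHat i f)) =
      tauHat (next i) (tauHat i (tauHat (next i) f)) := by
  have hik : i ≠ next (next i) := by
    intro he
    have h1 := coe_next hi
    have h2 := coe_next hj
    rw [← he] at h2
    omega
  simp only [tauHat_eq, isobaric_sub hi, isobaric_sub hj, isobaric_isobaric hi,
    isobaric_isobaric hj, isobaric_braid hi hj hik]
  ring

theorem tauHat_zero {i : Fin n} (hi : i ≠ next i) : tauHat i (0 : Poly n) = 0 := by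
  rw [tauHat_eq, isobaric_zero hi, sub_zero]

theorem isobaric_tauHat {i : Fin n} (hi : i ≠ next i) (f : Poly n) :
    isobaric i (next i) (tauHat i f) = 0 := by
  rw [tauHat_eq, isobaric_sub hi, isobaric_isobaric hi, sub_self]

end Operators

/-! ### Operator atoms and operator Lascoux polynomials -/

section OperatorPolynomials

variable {n : ℕ}

theorem operatorPoly_of_ascents_eq_empty (T : Fin n → Poly n → Poly n) {a : Fin n → ℕ}
    (h : ascents a = ∅) : operatorPoly T a = monom a := by
  rw [operatorPoly, dif_neg (by rw [h]; exact Finset.not_nonempty_empty)]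

theorem exists_ascent (T : Fin n → Poly n → Poly n) {a : Fin n → ℕ} (h : ascents a ≠ ∅) :
    ∃ j, a j < a (next j) ∧ operatorPoly T a = T j (operatorPoly T (a ∘ Equiv.swap j (next j))) := by
  have hne := Finset.nonempty_iff_ne_empty.2 h
  refine ⟨_, (Finset.mem_filter.1 ((ascents a).min'_mem hne)).2, ?_⟩
  rw [operatorPoly, dif_pos hne]

theorem ne_next_of_lt {a : Fin n → ℕ} {i : Fin n} (h : a i < a (next i)) : i ≠ next i :=
  fun e => by rw [← e] at h; exact lt_irrefl _ h

theorem lt_next {i : Fin n} (h : i ≠ next i) : i < next i := by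
  rw [Fin.lt_def, coe_next h]
  omega

theorem moment_swap_next_lt {a : Fin n → ℕ} {i : Fin n} (h : a i < a (next i)) :
    moment (a ∘ Equiv.swap i (next i)) < moment a :=
  moment_comp_swap_lt a (lt_next (ne_next_of_lt h)) h

theorem comp_swap_comm (a : Fin n → ℕ) {i j k l : Fin n} (hik : i ≠ k) (hil : i ≠ l) (hjk : j ≠ k)
    (hjl : j ≠ l) : (a ∘ Equiv.swap i j) ∘ Equiv.swap k l =
      (a ∘ Equiv.swap k l) ∘ Equiv.swap i j := by
  funext x
  simp only [Function.comp_apply, Equiv.swap_apply_def]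
  grind

theorem comp_swap_braid (a : Fin n → ℕ) {i j k : Fin n} (hij : i ≠ j) (hjk : j ≠ k) (hik : i ≠ k) :
    ((a ∘ Equiv.swap i j) ∘ Equiv.swap j k) ∘ Equiv.swap i j =
      ((a ∘ Equiv.swap j k) ∘ Equiv.swap i j) ∘ Equiv.swap j k := by
  funext x
  simp only [Function.comp_apply, Equiv.swap_apply_def]
  grind

/-- Independence of the choice of ascent. If `j` is the ascent used in the definition, `i` and `j`
are equal, adjacent (braid relation) or far apart (commutation). The second claim starts from a
monomial symmetric in `x_i` and `x_{i+1}` and is carried along by the same relations. -/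
theorem opLascouxAtom_swap_next (a : Fin n → ℕ) (i : Fin n) :
    (a i < a (next i) →
      opLascouxAtom a = tauHat i (opLascouxAtom (a ∘ Equiv.swap i (next i)))) ∧
    (i ≠ next i → a i = a (next i) → tauHat i (opLascouxAtom a) = 0) := by
  unfold opLascouxAtom
  induction hm : moment a using Nat.strong_induction_on generalizing a i with
  | _ N ih =>
  have ih1 : ∀ b, moment b < moment a → ∀ i, b i < b (next i) →
      operatorPoly tauHat b = tauHat i (operatorPoly tauHat (b ∘ Equiv.swap i (next i))) :=
    fun b hb i => (ih _ (hm ▸ hb) b i rfl).1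
  have ih2 : ∀ b, moment b < moment a → ∀ i, i ≠ next i → b i = b (next i) →
      tauHat i (operatorPoly tauHat b) = 0 :=
    fun b hb i => (ih _ (hm ▸ hb) b i rfl).2
  clear ih
  by_cases hasc : ascents a = ∅
  · refine ⟨fun h => ?_, fun hi h => ?_⟩
    · have : i ∈ ascents a := Finset.mem_filter.2 ⟨Finset.mem_univ _, h⟩
      rw [hasc] at this
      exact absurd this (Finset.notMem_empty i)
    · rw [operatorPoly_of_ascents_eq_empty _ hasc, tauHat_eq, isobaric_of_symmetric hi, sub_self]
      rw [swapVars_monom]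
      congr 1
      funext x
      rw [Function.comp_apply, Equiv.swap_apply_def]
      split_ifs <;> subst_vars <;> simp [h]
  obtain ⟨j, hj, hPj⟩ := exists_ascent tauHat hasc
  have hjn := ne_next_of_lt hj
  by_cases hij : i = j
  · subst hij
    exact ⟨fun _ => hPj, fun _ h => absurd h hj.ne⟩
  by_cases hin : i = next i
  · exact ⟨fun h => absurd hin (ne_next_of_lt h), fun h => absurd hin h⟩
  have hvi := coe_next hin
  have hvj := coe_next hjn
  by_cases h1 : next i = j
  · subst h1
    have hik : i ≠ next (next i) := fun e => by rw [← e] at hvj; omega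
    have v1 := Equiv.swap_apply_of_ne_of_ne hin hik
    have v2 := Equiv.swap_apply_of_ne_of_ne hik.symm hjn.symm
    have hbr := comp_swap_braid a hin hjn hik
    have m1 := moment_swap_next_lt hj
    refine ⟨fun h => ?_, fun _ h => ?_⟩
    · have h2 : (a ∘ Equiv.swap (next i) (next (next i))) i <
          (a ∘ Equiv.swap (next i) (next (next i))) (next i) := by
        simpa [v1] using h.trans hj
      have m2 := (moment_swap_next_lt h2).trans m1
      have h4 : (a ∘ Equiv.swap i (next i)) (next i) <
          (a ∘ Equiv.swap i (next i)) (next (next i)) := by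
        simpa [v2] using h.trans hj
      have m4 := moment_swap_next_lt h
      rw [hPj, ih1 _ m1 i h2, ih1 _ m2 (next i) (by simpa [v1, v2] using h), ih1 _ m4 (next i) h4,
        ih1 _ ((moment_swap_next_lt h4).trans m4) i (by simpa [v1, v2] using hj), hbr,
        tauHat_braid hin hjn]
    -- The braid relation brings an operator at `next i` next to an atom whose parts at `next i` and
    -- the position after it are equal, and this operator annihilates the atom.
    · have h2 : (a ∘ Equiv.swap (next i) (next (next i))) i <
          (a ∘ Equiv.swap (next i) (next (next i))) (next i) := by
        simpa [v1] using h.trans_lt hj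
      have m2 := (moment_swap_next_lt h2).trans m1
      rw [hPj, ih1 _ m1 i h2, tauHat_braid hin hjn,
        ih2 _ m2 (next i) hjn (by simpa [v1, v2] using h), tauHat_zero hin, tauHat_zero hjn]
  · by_cases h2 : next j = i
    · subst h2
      have hik : j ≠ next (next j) := fun e => by rw [← e] at hvi; omega
      have v1 := Equiv.swap_apply_of_ne_of_ne hjn hik
      have v2 := Equiv.swap_apply_of_ne_of_ne hik.symm (Ne.symm hin)
      have hbr := comp_swap_braid a hjn hin hik
      have m1 := moment_swap_next_lt hj
      refine ⟨fun h => ?_, fun _ h => ?_⟩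
      · have h2 : (a ∘ Equiv.swap j (next j)) (next j) <
            (a ∘ Equiv.swap j (next j)) (next (next j)) := by
          simpa [v2] using hj.trans h
        have m2 := (moment_swap_next_lt h2).trans m1
        have h4 : (a ∘ Equiv.swap (next j) (next (next j))) j <
            (a ∘ Equiv.swap (next j) (next (next j))) (next j) := by
          simpa [v1] using hj.trans h
        have m4 := moment_swap_next_lt h
        rw [hPj, ih1 _ m1 (next j) h2, ih1 _ m2 j (by simpa [v1, v2] using h), ih1 _ m4 j h4,
          ih1 _ ((moment_swap_next_lt h4).trans m4) (next j) (by simpa [v1, v2] using hj), ← hbr,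
          tauHat_braid hjn hin]
      · have h2 : (a ∘ Equiv.swap j (next j)) (next j) <
            (a ∘ Equiv.swap j (next j)) (next (next j)) := by
          simpa [v2] using hj.trans_eq h
        have m2 := (moment_swap_next_lt h2).trans m1
        rw [hPj, ih1 _ m1 (next j) h2, ← tauHat_braid hjn hin,
          ih2 _ m2 j hjn (by simpa [v1, v2] using h), tauHat_zero hin, tauHat_zero hjn]
    · have h3 : next i ≠ next j := fun e => hij (Fin.ext (by rw [e] at hvi; omega))
      have v1 := Equiv.swap_apply_of_ne_of_ne hij (Ne.symm h2)
      have v2 := Equiv.swap_apply_of_ne_of_ne h1 h3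
      have v3 := Equiv.swap_apply_of_ne_of_ne (Ne.symm hij) (Ne.symm h1)
      have v4 := Equiv.swap_apply_of_ne_of_ne h2 h3.symm
      have hdis : Disjoint ({i, next i} : Set (Fin n)) {j, next j} := by
        simp [Ne.symm hij, Ne.symm h1, h3.symm, h2]
      have m1 := moment_swap_next_lt hj
      refine ⟨fun h => ?_, fun _ h => ?_⟩
      · rw [hPj, ih1 _ m1 i (by simpa [v1, v2] using h),
          ih1 _ (moment_swap_next_lt h) j (by simpa [v3, v4] using hj), tauHat_comm hin hjn hdis,
          comp_swap_comm a hij (Ne.symm h2) h1 h3]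
      · rw [hPj, tauHat_comm hin hjn hdis, ih2 _ m1 i hin (by simpa [v1, v2] using h),
          tauHat_zero hjn]

theorem opLascouxAtom_of_ascent {a : Fin n → ℕ} {i : Fin n} (h : a i < a (next i)) :
    opLascouxAtom a = tauHat i (opLascouxAtom (a ∘ Equiv.swap i (next i))) :=
  (opLascouxAtom_swap_next a i).1 h

theorem swap_comp_swap (a : Fin n → ℕ) (i j : Fin n) :
    (a ∘ Equiv.swap i j) ∘ Equiv.swap i j = a := by
  funext x
  simp

theorem isobaric_opLascouxAtom (a : Fin n → ℕ) {i : Fin n} (hi : i ≠ next i) :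
    isobaric i (next i) (opLascouxAtom a) =
      (if a (next i) < a i then opLascouxAtom (a ∘ Equiv.swap i (next i)) else 0) +
        if a (next i) ≤ a i then opLascouxAtom a else 0 := by
  rcases lt_trichotomy (a i) (a (next i)) with h | h | h
  · rw [if_neg h.not_gt, if_neg h.not_ge, opLascouxAtom_of_ascent h, isobaric_tauHat hi, add_zero]
  · have h1 := (opLascouxAtom_swap_next a i).2 hi h
    rw [if_neg h.not_gt, if_pos h.ge, zero_add]
    rwa [tauHat_eq, sub_eq_zero] at h1
  · have h1 := opLascouxAtom_of_ascent (a := a ∘ Equiv.swap i (next i)) (i := i) (by simpa using h)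
    rw [swap_comp_swap, tauHat_eq] at h1
    rw [if_pos h, if_pos h.le, h1, sub_add_cancel]

/-- The compositions `b` with `b_{i+1} ≤ b_i` are the same in both index sets, and the larger set is
stable under `s_i`. The terms from `s_i b` therefore supply exactly the missing compositions, those
with an ascent at `i`. -/
theorem isobaric_sum_lswap {a : Fin n → ℕ} {i : Fin n} (h : a i < a (next i)) :
    isobaric i (next i)
        (∑ b ∈ (lswap_finite (a ∘ Equiv.swap i (next i))).toFinset, opLascouxAtom b) =
      ∑ b ∈ (lswap_finite a).toFinset, opLascouxAtom b := by
  have hi := ne_next_of_lt h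
  have hmem : ∀ b : Fin n → ℕ, b (next i) ≤ b i →
      (b ∈ (lswap_finite (a ∘ Equiv.swap i (next i))).toFinset ↔
        b ∈ (lswap_finite a).toFinset) := by
    intro b hb
    rw [Set.Finite.mem_toFinset, Set.Finite.mem_toFinset]
    exact ⟨fun h1 => lswap_subset_of_ascent h h1, fun h1 => mem_lswap_comp_swap_next h h1 hb⟩
  have hstable : ∀ b ∈ (lswap_finite a).toFinset,
      b ∘ Equiv.swap i (next i) ∈ (lswap_finite a).toFinset := by
    intro b hb
    rw [Set.Finite.mem_toFinset] at hb ⊢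
    exact lswap_comp_swap_next h hb
  rw [isobaric_sum hi, Finset.sum_congr rfl fun b _ => isobaric_opLascouxAtom b hi,
    Finset.sum_add_distrib, ← Finset.sum_filter, ← Finset.sum_filter,
    ← Finset.sum_filter_add_sum_filter_not (lswap_finite a).toFinset
      (fun b => b i < b (next i))]
  congr 1
  · refine Finset.sum_bij' (fun b _ => b ∘ Equiv.swap i (next i))
      (fun b _ => b ∘ Equiv.swap i (next i)) ?_ ?_ (fun b _ => swap_comp_swap b _ _)
      (fun b _ => swap_comp_swap b _ _) fun _ _ => rfl
    · intro b hb
      rw [Finset.mem_filter] at hb ⊢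
      exact ⟨hstable b ((hmem b hb.2.le).1 hb.1), by simpa using hb.2⟩
    · intro b hb
      rw [Finset.mem_filter] at hb ⊢
      have hlt : (b ∘ Equiv.swap i (next i)) (next i) < (b ∘ Equiv.swap i (next i)) i := by
        simpa using hb.2
      exact ⟨(hmem _ hlt.le).2 (hstable b hb.1), hlt⟩
  · refine Finset.sum_congr ?_ fun _ _ => rfl
    ext b
    rw [Finset.mem_filter, Finset.mem_filter, not_lt]
    exact and_congr_left fun hb => hmem b hb

theorem antitone_of_ascents_eq_empty {a : Fin n → ℕ} (h : ascents a = ∅) : Antitone a := by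
  have hstep : ∀ i, a (next i) ≤ a i := by
    intro i
    by_contra hcon
    have : i ∈ ascents a := Finset.mem_filter.2 ⟨Finset.mem_univ _, not_le.1 hcon⟩
    rw [h] at this
    exact absurd this (Finset.notMem_empty i)
  have key : ∀ t : ℕ, ∀ i j : Fin n, (j : ℕ) = i + t → a j ≤ a i := by
    intro t
    induction t with
    | zero =>
      intro i j hj
      rw [show j = i from Fin.ext (by omega)]
    | succ t ih =>
      intro i j hj
      have hlt : (i : ℕ) + 1 < n := by have := j.2; omega
      have hv : ((next i : Fin n) : ℕ) = i + 1 := by rw [next, dif_pos hlt]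
      exact (ih (next i) j (by omega)).trans (hstep i)
  intro i j hij
  exact key (j - i) i j (by have : (i : ℕ) ≤ j := hij; omega)

theorem lswap_of_antitone {a : Fin n → ℕ} (h : Antitone a) : lswap a = {a} := by
  ext b
  constructor
  · intro hb
    by_contra hne
    obtain ⟨i, j, hij, hlt, -⟩ := (mem_lswap_iff_dominates.1 hb).exists_swap hne
    exact absurd (h hij.le) (not_le.2 hlt)
  · rintro rfl
    exact Relation.ReflTransGen.refl

theorem opLascouxPoly_eq_sum_lswap (a : Fin n → ℕ) :
    opLascouxPoly a = ∑ b ∈ (lswap_finite a).toFinset, opLascouxAtom b := by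
  induction hm : moment a using Nat.strong_induction_on generalizing a with
  | _ N ih =>
  by_cases hasc : ascents a = ∅
  · have h1 : (lswap_finite a).toFinset = {a} := by
      ext b
      rw [Set.Finite.mem_toFinset, lswap_of_antitone (antitone_of_ascents_eq_empty hasc)]
      simp
    rw [h1, Finset.sum_singleton, opLascouxPoly, opLascouxAtom,
      operatorPoly_of_ascents_eq_empty _ hasc, operatorPoly_of_ascents_eq_empty _ hasc]
  · obtain ⟨j, hj, hPj⟩ := exists_ascent tau hasc
    have hrec := ih _ (hm ▸ moment_swap_next_lt hj) _ rfl
    rw [opLascouxPoly] at hrec ⊢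
    rw [hPj, hrec, tau_eq_isobaric, isobaric_sum_lswap hj]

/-- Every other element of `lswap a` has smaller moment, so the system is unitriangular. -/
theorem eq_of_sum_lswap_eq {M : Type*} [AddCommGroup M] {f g : (Fin n → ℕ) → M}
    (h : ∀ a, ∑ b ∈ (lswap_finite a).toFinset, f b = ∑ b ∈ (lswap_finite a).toFinset, g b)
    (a : Fin n → ℕ) : f a = g a := by
  induction hm : moment a using Nat.strong_induction_on generalizing a with
  | _ N ih =>
  have ha : a ∈ (lswap_finite a).toFinset :=
    (Set.Finite.mem_toFinset _).2 Relation.ReflTransGen.refl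
  have h1 := h a
  rw [← Finset.add_sum_erase _ f ha, ← Finset.add_sum_erase _ g ha,
    Finset.sum_congr rfl fun b hb => ih _ (hm ▸ moment_lt_of_mem_lswap
      ((Set.Finite.mem_toFinset _).1 (Finset.mem_of_mem_erase hb)) (Finset.ne_of_mem_erase hb))
      b rfl] at h1
  exact add_right_cancel h1

end OperatorPolynomials

end Lascoux

/-! ### The main theorem. -/

theorem mainTheorem4 (n : ℕ) :
    (∀ a : Fin n → ℕ,
      Lascoux.lascouxPoly a =
        ∑ b ∈ (Lascoux.bruhatBelow_finite a).toFinset, Lascoux.lascouxAtom b ∧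
      Lascoux.lswap a = Lascoux.bruhatBelow a ∧
      Lascoux.lascouxPoly a =
        ∑ b ∈ (Lascoux.lswap_finite a).toFinset, Lascoux.lascouxAtom b ∧
      ∃ c : (Fin n → ℕ) →₀ Polynomial ℕ,
        Lascoux.lascouxPoly a =
          c.sum fun b p =>
            MvPolynomial.C (p.map (Nat.castRingHom ℤ)) * Lascoux.lascouxAtom b) ∧
    ((∀ a : Fin n → ℕ, Lascoux.opLascouxAtom a = Lascoux.lascouxAtom a) ↔
      (∀ a : Fin n → ℕ, Lascoux.opLascouxPoly a = Lascoux.lascouxPoly a)) := by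
  refine ⟨fun a => ?_, fun h a => ?_, fun h => ?_⟩
  · have hsum := Lascoux.lascouxPoly_eq_sum_lswap a
    refine ⟨?_, Lascoux.lswap_eq_bruhatBelow a, hsum, ?_⟩
    · rw [hsum]
      congr 1
      ext b
      rw [Set.Finite.mem_toFinset, Set.Finite.mem_toFinset, Lascoux.lswap_eq_bruhatBelow]
    · classical
      -- All coefficients on `lswap a` are `1`.
      refine ⟨Finsupp.indicator (Lascoux.lswap_finite a).toFinset fun _ _ => 1, ?_⟩
      rw [hsum, Finsupp.sum_of_support_subset _ (Finsupp.support_indicator_subset _ _) _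
        (fun b _ => by simp)]
      refine Finset.sum_congr rfl fun b hb => ?_
      rw [Finsupp.indicator_of_mem hb]
      simp
  · rw [Lascoux.opLascouxPoly_eq_sum_lswap, Lascoux.lascouxPoly_eq_sum_lswap]
    exact Finset.sum_congr rfl fun b _ => h b
  · refine Lascoux.eq_of_sum_lswap_eq fun a => ?_
    rw [← Lascoux.opLascouxPoly_eq_sum_lswap, ← Lascoux.lascouxPoly_eq_sum_lswap, h a]
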